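/- \textbf{Definitions.} Let $X$ be a topological space. An $n$-cell structure on a subspace $e\subset X$ is a pair $(D,\varphi)$ with $\operatorname{Int}(D^n)\subset D\subset D^n$ and $\varphi\colon D\to X$ continuous, such that $\varphi(D)=\overline e$, $\varphi$ restricts to a homeomorphism $\operatorname{Int}(D^n)\to e$, and $(D,\varphi)$ is maximal with these properties; put $\partial e=\overline e-e$ and $\partial D=D-\operatorname{Int}(D^n)$. A cellular stratification $\mathcal C$ on $X$ is a filtration $X_0\subset X_1\subset\cdots$ of $X$ with union $X$ such that each $X_n-X_{n-1}$ is the topological disjoint union of subspaces $e_\lambda$ with given $n$-cell structures $(D_\lambda,\varphi_\lambda)$ (the $n$-cells), such that $\partial e_\lambda$ is covered by finitely many cells of dimension $<n$ for each $n$-cell $e_\lambda$, and such that $X$ has the weak topology determined by the closures of the cells. A union $A$ of cells is a cellular stratified subspace if the cells contained in $A$, with domains $\varphi_\lambda^{-1}(A)$ and restricted characteristic maps, form a cellular stratification of $A$. An isomorphism $(X,\mathcal C)\to(X',\mathcal C')$ is a homeomorphism $f$ such that for each $n$-cell $e$ of $\mathcal C$ there is an $n$-cell $e'$ of $\mathcal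 C'$ with $D_e=D_{e'}$, $f(e)=e'$ and $\varphi_{e'}=f\circ\varphi_e$; an embedding is a topological embedding that is an isomorphism onto a cellular stratified subspace. An action of a group $G$ on $X$ is cellular if each $g\in G$ acts by an isomorphism of $(X,\mathcal C)$ with itself. $\mathcal C$ is regular if every $\varphi_\lambda$ is a homeomorphism onto $\overline{e_\lambda}$; it is a CW structure if $D_\lambda=D^n$ for every $n$-cell; it is normal if $\partial e_\lambda$ is a union of finitely many cells of dimension $<n$ for every $n$-cell $e_\lambda$. It is totally normal if it is normal and, for each $n$-cell $e_\lambda$, there is a regular CW structure on $S^{n-1}$ containing $\partial D_\lambda$ as a cellular stratified subspace such that for each cell $c$ of $\partial D_\lambda$ there is a cell $e_\mu\subset\partial e_\lambda$ with the same domain as $c$ and $\varphi_\mu=\varphi_\lambda\circ\varphi_c$. The face poset $F(\mathcal C)$ is the set of cells, ordered by $e'\le e$ iff $e'\subset\overline e$, and $\operatorname{Sd}(\mathcal C)$ is the geometric realization (with the weak topology) of its order complex. An embedding $f\colon(X,\mathcal C)\to(X',\mathcal C')$ induces $\operatorname{Sd}(f)\colon\operatorname{Sd}(\mathcal C)\to\operatorname{Sd}(\mathcal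 C')$ through $e\mapsto f(e)$. \textbf{Theorem.} To every regular, totally normal cellular stratification $\mathcal C$ on a topological space $X$ one can assign maps $i_{\mathcal C}\colon\operatorname{Sd}(\mathcal C)\to X$ and $H_{\mathcal C}\colon X\times[0,1]\to X$ with the following properties. (1) $i_{\mathcal C}$ is a topological embedding, and $H_{\mathcal C}$ is a strong deformation retraction of $X$ onto $i_{\mathcal C}(\operatorname{Sd}(\mathcal C))$: it is continuous, $H_{\mathcal C}(x,0)=x$ and $H_{\mathcal C}(x,1)\in i_{\mathcal C}(\operatorname{Sd}(\mathcal C))$ for all $x\in X$, and $H_{\mathcal C}(a,t)=a$ for all $a\in i_{\mathcal C}(\operatorname{Sd}(\mathcal C))$ and $t\in[0,1]$. (2) If $\mathcal C$ is moreover a CW structure, then $i_{\mathcal C}$ is a homeomorphism. (3) $i$ is natural for embeddings of cellular stratified spaces: $i_{\mathcal C'}\circ\operatorname{Sd}(f)=f\circ i_{\mathcal C}$ for each embedding $f\colon(X,\mathcal C)\to(X',\mathcal C')$. $H$ is natural for those embeddings $f$ whose image is closed in $X'$ (equivalently, for which $\mathcal C$ and $\mathcal C'$ give $e$ and $f(e)$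 the same domain, for every cell $e$): $H_{\mathcal C'}(f(x),t)=f(H_{\mathcal C}(x,t))$ for all $x\in X$ and $t\in[0,1]$. (4) For each cellular action of a group $G$ on $X$, both $i_{\mathcal C}$ and $H_{\mathcal C}$ are $G$-equivariant. -/

import Mathlib

open Set Topology

universe u v w

/-- A system of cells on a set `X`, each with its domain and characteristic map: the data of a
cellular stratification, as yet without any condition. -/
structure CellSystem (X : Type u) where
  /-- the set of `n`-cells -/
  cell : ℕ → Type v
  /-- the subset of `X` that the cell is -/
  carrier : {n : ℕ} → cell n → Set X
  /-- the domain `D` of the cell -/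
  dom : {n : ℕ} → cell n → Set (EuclideanSpace ℝ (Fin n))
  /-- the characteristic map `D → X` of the cell -/
  char : {n : ℕ} → (e : cell n) → dom e → X

/-- `(D, φ)` satisfies all conditions of an `n`-cell structure on `e`, except for maximality:
`Int(Dⁿ) ⊆ D ⊆ Dⁿ`, `φ` is continuous, `φ(D)` is the closure of `e`, and `φ` restricts to a
homeomorphism from `Int(Dⁿ)` onto `e`. -/
structure IsPreCell {X : Type u} [TopologicalSpace X] {n : ℕ} (e : Set X)
    (D : Set (EuclideanSpace ℝ (Fin n))) (φ : D → X) : Prop where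
  ball_subset : Metric.ball 0 1 ⊆ D
  subset_closedBall : D ⊆ Metric.closedBall 0 1
  continuous_char : Continuous φ
  range_char : range φ = closure e
  isEmbedding_ball : IsEmbedding
    (fun x : Metric.ball (0 : EuclideanSpace ℝ (Fin n)) 1 => φ ⟨x.1, ball_subset x.2⟩)
  range_ball :
    range (fun x : Metric.ball (0 : EuclideanSpace ℝ (Fin n)) 1 => φ ⟨x.1, ball_subset x.2⟩) = e

/-- `(D, φ)` is an `n`-cell structure on `e`: it is maximal among the pairs with the properties
of `IsPreCell`. -/
structure IsCellStructure {X : Type u} [TopologicalSpace X] {n : ℕ} (e : Set X)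
    (D : Set (EuclideanSpace ℝ (Fin n))) (φ : D → X) : Prop extends IsPreCell e D φ where
  maximal : ∀ (D' : Set (EuclideanSpace ℝ (Fin n))) (φ' : D' → X), IsPreCell e D' φ' →
    ∀ h : D ⊆ D', (∀ x : D, φ' ⟨x.1, h x.2⟩ = φ x) → D' = D

namespace CellSystem

variable {X : Type u} (C : CellSystem.{u, v} X)

/-- The union of all `n`-cells; this is the difference of consecutive skeleta `Xₙ - Xₙ₋₁`, the
`n`-th skeleton being the union of all cells of dimension at most `n`. -/
def stratum (n : ℕ) : Set X := ⋃ e : C.cell n, C.carrier e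

/-- `A` is a union of cells. -/
def IsUnionOfCells (A : Set X) : Prop :=
  ∃ S : Set (Σ n, C.cell n), A = ⋃ s ∈ S, C.carrier s.2

/-- The cells contained in `A`, with the domains `D_A = φ⁻¹(A)` and the restricted
characteristic maps. -/
def restrict (A : Set X) : CellSystem.{u, v} A where
  cell n := {e : C.cell n // C.carrier e ⊆ A}
  carrier e := Subtype.val ⁻¹' C.carrier e.1
  dom e := {x | ∃ h : x ∈ C.dom e.1, C.char e.1 ⟨x, h⟩ ∈ A}
  char e x := ⟨C.char e.1 ⟨x.1, x.2.1⟩, x.2.2⟩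

variable [TopologicalSpace X]

/-- `∂e = closure e - e`. -/
def bdry {n : ℕ} (e : C.cell n) : Set X := closure (C.carrier e) \ C.carrier e

/-- The conditions on a system of cells to be a cellular stratification. -/
structure IsStratification : Prop where
  isCell : ∀ {n : ℕ} (e : C.cell n), IsCellStructure (C.carrier e) (C.dom e) (C.char e)
  cover : (⋃ n, C.stratum n) = univ
  disjoint : Pairwise fun s t : (Σ n, C.cell n) => Disjoint (C.carrier s.2) (C.carrier t.2)
  /-- `Xₙ - Xₙ₋₁` is the topological disjoint union of the `n`-cells: each is open in it. -/
  isOpen_stratum : ∀ {n : ℕ} (e : C.cell n),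
    IsOpen (Subtype.val ⁻¹' C.carrier e : Set (C.stratum n))
  closure_finite : ∀ {n : ℕ} (e : C.cell n), ∃ S : Set (Σ m, C.cell m),
    S.Finite ∧ (∀ s ∈ S, s.1 < n) ∧ C.bdry e ⊆ ⋃ s ∈ S, C.carrier s.2
  weak_topology : IsCoherentWith {B : Set X | ∃ (n : ℕ) (e : C.cell n), B = closure (C.carrier e)}

/-- `A` is a cellular stratified subspace. -/
def IsStratifiedSubspace (A : Set X) : Prop :=
  C.IsUnionOfCells A ∧ (C.restrict A).IsStratification

/-- All cells are regular: the characteristic map is a homeomorphism onto the closure. -/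
def IsRegular : Prop := ∀ {n : ℕ} (e : C.cell n), IsEmbedding (C.char e)

/-- All cells are closed: `D = Dⁿ`. -/
def IsCW : Prop := ∀ {n : ℕ} (e : C.cell n), C.dom e = Metric.closedBall 0 1

/-- The boundary of each `n`-cell is a union of finitely many cells of dimension less than `n`. -/
def IsNormal : Prop := ∀ {n : ℕ} (e : C.cell n), ∃ S : Set (Σ m, C.cell m),
  S.Finite ∧ (∀ s ∈ S, s.1 < n) ∧ C.bdry e = ⋃ s ∈ S, C.carrier s.2

/-- `∂D = D - Int(Dⁿ)`, as a subset of the unit sphere. -/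
def domBdry {n : ℕ} (e : C.cell n) : Set (Metric.sphere (0 : EuclideanSpace ℝ (Fin n)) 1) :=
  {x | x.1 ∈ C.dom e}

/-- Total normality: normality, and for each `n`-cell `e` there is a regular CW structure `K` on
`Sⁿ⁻¹` that contains `∂D` as a stratified subspace, such that for each cell `c` of `∂D` there is a
cell `d` in `∂e` with the same domain as `c` and with `φ_d = φ_e ∘ φ_c`. -/
def IsTotallyNormal : Prop :=
  C.IsNormal ∧ ∀ {n : ℕ} (e : C.cell n),
    ∃ K : CellSystem.{0, 0} (Metric.sphere (0 : EuclideanSpace ℝ (Fin n)) 1),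
      K.IsStratification ∧ K.IsRegular ∧ K.IsCW ∧ K.IsStratifiedSubspace (C.domBdry e) ∧
      ∀ {m : ℕ} (c : (K.restrict (C.domBdry e)).cell m), ∃ d : C.cell m,
        C.carrier d ⊆ C.bdry e ∧ C.dom d = (K.restrict (C.domBdry e)).dom c ∧
        ∀ (x : EuclideanSpace ℝ (Fin m)) (hx : x ∈ C.dom d)
          (hx' : x ∈ (K.restrict (C.domBdry e)).dom c),
          C.char d ⟨x, hx⟩ =
            C.char e ⟨((K.restrict (C.domBdry e)).char c ⟨x, hx'⟩).1.1,
              ((K.restrict (C.domBdry e)).char c ⟨x, hx'⟩).2⟩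

variable {X' : Type w} [TopologicalSpace X'] (C' : CellSystem.{w, v} X')

/-- `f` is an isomorphism of cellular stratified spaces. -/
def IsIso (f : X → X') : Prop :=
  IsHomeomorph f ∧ ∀ {n : ℕ} (e : C.cell n), ∃ e' : C'.cell n,
    C.dom e = C'.dom e' ∧ f '' C.carrier e = C'.carrier e' ∧
    ∀ (x : EuclideanSpace ℝ (Fin n)) (hx : x ∈ C.dom e) (hx' : x ∈ C'.dom e'),
      C'.char e' ⟨x, hx'⟩ = f (C.char e ⟨x, hx⟩)

/-- `f` is an embedding of cellular stratified spaces: a topological embedding that is an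
isomorphism onto a cellular stratified subspace. -/
def IsEmb (f : X → X') : Prop :=
  IsEmbedding f ∧ C'.IsStratifiedSubspace (range f) ∧
    C.IsIso (C'.restrict (range f)) (rangeFactorization f)

/-- `f` is continuous and maps each `n`-cell onto an `n`-cell. -/
def MapsCells (f : X → X') : Prop :=
  Continuous f ∧ ∀ {n : ℕ} (e : C.cell n), ∃ e' : C'.cell n, f '' C.carrier e = C'.carrier e'

variable {C C'} in
theorem IsIso.mapsCells {f : X → X'} (hf : C.IsIso C' f) : C.MapsCells C' f :=
  ⟨hf.1.continuous, fun e => by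
    obtain ⟨e', -, h, -⟩ := hf.2 e
    exact ⟨e', h⟩⟩

variable {C C'} in
theorem IsEmb.mapsCells {f : X → X'} (hf : C.IsEmb C' f) : C.MapsCells C' f :=
  ⟨hf.1.continuous, fun e => by
    obtain ⟨e', -, h, -⟩ := hf.2.2.2 e
    refine ⟨e'.1, ?_⟩
    have h2 : Subtype.val '' (rangeFactorization f '' C.carrier e)
        = Subtype.val '' ((Subtype.val : range f → X') ⁻¹' C'.carrier e'.1) :=
      congrArg (fun s => Subtype.val '' s) h
    rw [Subtype.image_preimage_coe, inter_eq_right.2 e'.2, image_image] at h2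
    exact h2⟩

end CellSystem

/-- A cellular stratification on `X`. -/
structure CellularStratification (X : Type u) [TopologicalSpace X] extends
    CellSystem.{u, v} X where
  isStratification : toCellSystem.IsStratification

namespace CellularStratification

variable {X : Type u} [TopologicalSpace X]

/-- The set of all cells, the underlying set of the face poset. -/
def FacePoset (C : CellularStratification.{u, v} X) : Type v := Σ n, C.cell n

theorem carrier_nonempty (C : CellularStratification.{u, v} X) {n : ℕ} (e : C.cell n) :
    (C.carrier e).Nonempty := by
  have h := (C.isStratification.isCell e).range_ball
  rw [← h]
  exact ⟨_, ⟨⟨0, by simp⟩, rfl⟩⟩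

theorem dim_lt_of_subset (C : CellularStratification.{u, v} X) (s t : Σ n, C.cell n)
    (hne : s ≠ t) (h : C.carrier s.2 ⊆ closure (C.carrier t.2)) : s.1 < t.1 := by
  obtain ⟨x, hx⟩ := C.carrier_nonempty s.2
  have hd := C.isStratification.disjoint
  obtain ⟨S, -, hS, hcov⟩ := C.isStratification.closure_finite t.2
  have hxb : x ∈ C.bdry t.2 := ⟨h hx, disjoint_left.1 (hd hne) hx⟩
  obtain ⟨r, hr, hxr⟩ := mem_iUnion₂.1 (hcov hxb)
  by_cases hrs : s = r
  · rw [hrs]; exact hS r hr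
  · exact absurd hxr (disjoint_left.1 (hd hrs) hx)

/-- The face order: `e' ≤ e` if `e'` is contained in the closure of `e`. -/
instance (C : CellularStratification.{u, v} X) : PartialOrder C.FacePoset where
  le s t := C.carrier s.2 ⊆ closure (C.carrier t.2)
  le_refl _ := subset_closure
  le_trans _ _ _ h h' := h.trans (closure_minimal h' isClosed_closure)
  le_antisymm s t h h' := by
    by_contra hne
    exact lt_asymm (C.dim_lt_of_subset s t hne h) (C.dim_lt_of_subset t s (Ne.symm hne) h')

end CellularStratification

/-- The geometric realization of the order complex of a poset `P`, in barycentric coordinates: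
finitely supported functions `P → [0, 1]` of sum `1` whose support is a chain. -/
@[ext]
structure OrderComplex (P : Type v) [PartialOrder P] where
  /-- the barycentric coordinates -/
  coord : P →₀ ℝ
  coord_nonneg : ∀ p, 0 ≤ coord p
  sum_coord : (coord.sum fun _ a => a) = 1
  isChain_support : IsChain (· ≤ ·) (coord.support : Set P)

namespace OrderComplex

variable {P : Type v} [PartialOrder P] {Q : Type w} [PartialOrder Q]

/-- The closed simplex spanned by a finite set `c`, which will be a chain. -/
def simplex (c : Finset P) : Set (OrderComplex P) := {t | t.coord.support ⊆ c}

/-- The Euclidean topology on a simplex, through its barycentric coordinates. -/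
abbrev simplexTopology (c : Finset P) : TopologicalSpace (simplex c) :=
  TopologicalSpace.induced (fun t (p : c) => t.1.coord p.1) (inferInstance : TopologicalSpace (c → ℝ))

/-- The weak topology: a set is open iff its intersection with each closed simplex is open. -/
instance : TopologicalSpace (OrderComplex P) :=
  ⨆ c : {c : Finset P // IsChain (· ≤ ·) (c : Set P)},
    TopologicalSpace.coinduced Subtype.val (simplexTopology c.1)

/-- The simplicial map induced by a monotone map. -/
noncomputable def map (F : P →o Q) (t : OrderComplex P) : OrderComplex Q where
  coord := t.coord.mapDomain F
  coord_nonneg q := by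
    classical
    rw [Finsupp.mapDomain, Finsupp.sum_apply]
    refine Finset.sum_nonneg fun p _ => ?_
    change 0 ≤ Finsupp.single (F p) (t.coord p) q
    rw [Finsupp.single_apply]
    split_ifs
    exacts [t.coord_nonneg p, le_rfl]
  sum_coord := by
    rw [Finsupp.sum_mapDomain_index (fun _ => rfl) (fun _ _ _ => rfl)]
    exact t.sum_coord
  isChain_support := by
    classical
    have h : ((t.coord.mapDomain F).support : Set Q) ⊆ F '' (t.coord.support : Set P) := by
      intro q hq
      have h2 := Finsupp.mapDomain_support hq
      simpa using h2
    refine IsChain.mono h ?_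
    rintro _ ⟨a, ha, rfl⟩ _ ⟨b, hb, rfl⟩ hne
    rcases t.isChain_support ha hb (fun hab => hne (congrArg F hab)) with hab | hab
    exacts [Or.inl (F.monotone hab), Or.inr (F.monotone hab)]

end OrderComplex

namespace CellularStratification

variable {X : Type u} [TopologicalSpace X] {X' : Type w} [TopologicalSpace X']

/-- The barycentric subdivision. -/
abbrev Sd (C : CellularStratification.{u, v} X) : Type v := OrderComplex C.FacePoset

/-- The map `e ↦ f(e)` of face posets. -/
noncomputable def faceMap {C : CellularStratification.{u, v} X}
    {C' : CellularStratification.{w, v} X'} {f : X → X'}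
    (hf : C.MapsCells C'.toCellSystem f) : C.FacePoset →o C'.FacePoset where
  toFun s := ⟨s.1, (hf.2 s.2).choose⟩
  monotone' s t h := by
    change C'.carrier (hf.2 s.2).choose ⊆ closure (C'.carrier (hf.2 t.2).choose)
    rw [← (hf.2 s.2).choose_spec, ← (hf.2 t.2).choose_spec]
    exact (image_mono h).trans (image_closure_subset_closure_image hf.1)

/-- The induced map of barycentric subdivisions. -/
noncomputable def sdMap {C : CellularStratification.{u, v} X}
    {C' : CellularStratification.{w, v} X'} {f : X → X'}
    (hf : C.MapsCells C'.toCellSystem f) : C.Sd → C'.Sd :=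
  OrderComplex.map (faceMap hf)

end CellularStratification

/-- `H` is a strong deformation retraction of `X` onto the subset `A`. -/
structure IsStrongDeformationRetraction {X : Type u} [TopologicalSpace X] (A : Set X)
    (H : C(X × unitInterval, X)) : Prop where
  start : ∀ x, H (x, 0) = x
  finish : ∀ x, H (x, 1) ∈ A
  stationary : ∀ a ∈ A, ∀ t, H (a, t) = a

/-! The map `i` is defined by coning. If a chain of cells has greatest element `e`, the smaller
cells give by recursion a point of `∂e`. Since `e` is regular, this point has coordinates in the
domain `D`, and the segment from the centre of `D` to it is divided according to the weight of `e`.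
Thus a point in the image determines the greatest cell (the cell that contains it), the weight of
that cell (from its norm in `D`) and, by its direction, the rest of the simplex; so `i` is
injective. By normality only finitely many simplices lie over the closure of a cell. They are
compact, and with the weak topology on `X` this makes `i` a closed embedding
(`isClosedEmbedding_sdIncl`). In `D` the image is a cone over its part in the boundary
(`charExt_mem_range_iff`). For a CW structure no ray is missing, and `i` is onto.

The deformation is built by induction on dimension. On a cell it must extend the homotopy already
given on `∂D`, end in the part `B` of `D` that lies over the image, and be stationary on `B`. Two
extension theorems achieve this. The end map `D → B` exists because the order complex of the faces
of `e`, a finite poset with greatest element, is an absolute extensor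
(`exists_extension_of_isGreatest`). The homotopy exists because `D`, a set between the open and the
closed ball, is one as well (`exists_extension_of_ball_subset`).

The extension is not given by a formula but chosen, once for each triple of a domain, a set `B` and
a boundary homotopy in Euclidean space (`cellHomotopy`). Embeddings with closed image preserve these
triples, by induction on dimension, and therefore the choices; this gives naturality and
equivariance of `H` (`map_retract`). -/

/-! ### Order complexes: continuity, compactness, extension of maps. -/

namespace OrderComplex

variable {P : Type v} [PartialOrder P]

/-- The point with the barycentric coordinates `w p` for `p` in a finite set `F`. -/
noncomputable def ofWeights (F : Finset P) (w : P → ℝ) (h0 : ∀ p ∈ F, 0 ≤ w p)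
    (h1 : ∑ p ∈ F, w p = 1) (hF : ∀ p ∈ F, ∀ q ∈ F, 0 < w p → 0 < w q → p ≤ q ∨ q ≤ p) :
    OrderComplex P where
  coord := Finsupp.indicator F fun p _ => w p
  coord_nonneg p := by
    classical
    rw [Finsupp.indicator_apply]
    split_ifs with h
    exacts [h0 p h, le_rfl]
  sum_coord := by
    classical
    rw [Finsupp.sum_of_support_subset _ (Finsupp.support_indicator_subset _ _) _
      (fun _ _ => rfl), ← h1]
    exact Finset.sum_congr rfl fun p hp => by rw [Finsupp.indicator_of_mem hp]
  isChain_support := by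
    classical
    have key : ∀ p, p ∈ (Finsupp.indicator F fun p _ => w p).support → p ∈ F ∧ 0 < w p := by
      intro p hp
      rw [Finsupp.mem_support_iff, Finsupp.indicator_apply] at hp
      split_ifs at hp with h
      · exact ⟨h, lt_of_le_of_ne (h0 p h) (Ne.symm hp)⟩
      · exact absurd rfl hp
    intro p hp q hq _
    exact hF p (key p hp).1 q (key q hq).1 (key p hp).2 (key q hq).2

section ofWeights

variable {F : Finset P} {w : P → ℝ} {h0 : ∀ p ∈ F, 0 ≤ w p} {h1 : ∑ p ∈ F, w p = 1}
  {hF : ∀ p ∈ F, ∀ q ∈ F, 0 < w p → 0 < w q → p ≤ q ∨ q ≤ p}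

theorem ofWeights_coord_of_mem {p : P} (hp : p ∈ F) :
    (ofWeights F w h0 h1 hF).coord p = w p :=
  Finsupp.indicator_of_mem hp fun p _ => w p

theorem ofWeights_coord_of_notMem {p : P} (hp : p ∉ F) :
    (ofWeights F w h0 h1 hF).coord p = 0 :=
  Finsupp.indicator_of_notMem hp fun p _ => w p

theorem support_ofWeights_subset : (ofWeights F w h0 h1 hF).coord.support ⊆ F :=
  Finsupp.support_indicator_subset _ _

end ofWeights

theorem sum_coord_of_subset (t : OrderComplex P) {F : Finset P} (h : t.coord.support ⊆ F) :
    ∑ p ∈ F, t.coord p = 1 := by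
  rw [← t.sum_coord, Finsupp.sum_of_support_subset _ h _ (fun _ _ => rfl)]

theorem support_nonempty (t : OrderComplex P) : t.coord.support.Nonempty := by
  by_contra h
  rw [Finset.not_nonempty_iff_eq_empty] at h
  have := t.sum_coord_of_subset h.subset
  simp at this

theorem continuous_iff {Y : Type*} [TopologicalSpace Y] {g : OrderComplex P → Y} :
    Continuous g ↔ ∀ c : Finset P, IsChain (· ≤ ·) (c : Set P) →
      @Continuous (simplex c) Y (simplexTopology c) _ (fun t => g t.1) := by
  constructor
  · intro h c hc
    refine @Continuous.comp (simplex c) (OrderComplex P) Y (simplexTopology c) _ _ Subtype.val g h ?_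
    exact continuous_iff_coinduced_le.2
      (le_iSup (fun c : {c : Finset P // IsChain (· ≤ ·) (c : Set P)} =>
        TopologicalSpace.coinduced (Subtype.val : simplex c.1 → OrderComplex P)
          (simplexTopology c.1)) ⟨c, hc⟩)
  · intro h
    refine continuous_iSup_dom.2 fun c => ?_
    exact continuous_coinduced_dom.2 (h c.1 c.2)

theorem continuous_simplex_val {c : Finset P} (hc : IsChain (· ≤ ·) (c : Set P)) :
    @Continuous (simplex c) (OrderComplex P) (simplexTopology c) _ Subtype.val :=
  continuous_iff.1 continuous_id c hc

theorem continuous_simplex_coord (c : Finset P) (p : P) :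
    @Continuous (simplex c) ℝ (simplexTopology c) _ (fun t => t.1.coord p) := by
  let _ := simplexTopology c
  by_cases hp : p ∈ c
  · have h : Continuous (fun (t : simplex c) (p : c) => t.1.coord p.1) := continuous_induced_dom
    exact (continuous_apply (⟨p, hp⟩ : c)).comp h
  · have h : (fun t : simplex c => t.1.coord p) = fun _ => 0 := by
      funext t
      exact Finsupp.notMem_support_iff.1 fun h => hp (t.2 h)
    rw [h]
    exact continuous_const

theorem continuous_coord (p : P) : Continuous fun t : OrderComplex P => t.coord p :=
  continuous_iff.2 fun c _ => continuous_simplex_coord c p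

/-- A map into an order complex is continuous if its coordinates are and if its image meets only
finitely many simplices. -/
theorem continuous_of_coord {Y : Type*} [TopologicalSpace Y] {g : Y → OrderComplex P}
    (F : Finset P) (hF : ∀ y, (g y).coord.support ⊆ F)
    (hg : ∀ p, Continuous fun y => (g y).coord p) : Continuous g := by
  classical
  -- The finitely many closed sets `A c` cover `Y`. On each of them `g` lands in a single simplex,
  -- whose topology is given by the coordinates.
  let A : {c // c ∈ F.powerset ∧ IsChain (· ≤ ·) (c : Set P)} → Set Y :=
    fun c => {y | ∀ p ∈ F \ c.1, (g y).coord p = 0}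
  have : Finite {c // c ∈ F.powerset ∧ IsChain (· ≤ ·) (c : Set P)} :=
    (F.powerset.finite_toSet.subset fun c hc => hc.1 :
      {c | c ∈ F.powerset ∧ IsChain (· ≤ ·) (c : Set P)}.Finite)
  have hA : ∀ c y, y ∈ A c ↔ (g y).coord.support ⊆ c.1 := by
    intro c y
    constructor
    · intro h p hp
      by_contra hpc
      exact Finsupp.mem_support_iff.1 hp (h p (Finset.mem_sdiff.2 ⟨hF y hp, hpc⟩))
    · intro h p hp
      exact Finsupp.notMem_support_iff.1 fun hps => (Finset.mem_sdiff.1 hp).2 (h hps)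
  refine (locallyFinite_of_finite A).continuous (iUnion_eq_univ_iff.2 fun y => ?_)
    (fun c => ?_) (fun c => ?_)
  · exact ⟨⟨(g y).coord.support, Finset.mem_powerset.2 (hF y), (g y).isChain_support⟩,
      (hA _ y).2 subset_rfl⟩
  · have : A c = ⋂ p ∈ F \ c.1, {y | (g y).coord p = 0} := by
      ext y
      simp [A]
    rw [this]
    exact isClosed_biInter fun p _ => isClosed_eq (hg p) continuous_const
  · rw [continuousOn_iff_continuous_domRestrict]
    let _ := simplexTopology c.1
    let l : A c → simplex c.1 := fun y => ⟨g y, (hA c y).1 y.2⟩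
    have hl : Continuous l :=
      continuous_induced_rng.2 (continuous_pi fun p => (hg p).comp continuous_subtype_val)
    exact (continuous_simplex_val c.2.2).comp hl

theorem isCompact_simplex {c : Finset P} (hc : IsChain (· ≤ ·) (c : Set P)) :
    IsCompact (simplex c) := by
  classical
  let e : (c → ℝ) → P → ℝ := fun w p => if h : p ∈ c then w ⟨p, h⟩ else 0
  have he : ∀ w (p : c), e w p = w p := fun w p => by simp [e]
  let g : stdSimplex ℝ c → OrderComplex P := fun w => ofWeights c (e w.1)
    (fun p hp => by rw [he _ ⟨p, hp⟩]; exact w.2.1 _)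
    (by rw [← Finset.sum_coe_sort, ← w.2.2]; exact Finset.sum_congr rfl fun p _ => he _ p)
    (fun p hp q hq _ _ => hc.total hp hq)
  have hg : Continuous g := by
    refine continuous_of_coord c (fun w => support_ofWeights_subset) fun p => ?_
    by_cases hp : p ∈ c
    · simp only [g, ofWeights_coord_of_mem hp, he _ ⟨p, hp⟩]
      exact (continuous_apply _).comp continuous_subtype_val
    · simp only [g, ofWeights_coord_of_notMem hp]
      exact continuous_const
  have hr : simplex c = range g := by
    refine Subset.antisymm (fun t ht => ?_) ?_
    · refine ⟨⟨fun p => t.coord p, fun p => t.coord_nonneg p, ?_⟩, ?_⟩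
      · rw [Finset.sum_coe_sort c fun p => t.coord p]
        exact t.sum_coord_of_subset ht
      · ext p
        by_cases hp : p ∈ c
        · simp only [g, ofWeights_coord_of_mem hp, he _ ⟨p, hp⟩]
        · simp only [g, ofWeights_coord_of_notMem hp]
          exact (Finsupp.notMem_support_iff.1 fun h => hp (ht h)).symm
    · rintro _ ⟨w, rfl⟩
      exact support_ofWeights_subset
  rw [hr]
  exact isCompact_range hg

/-- The order complex of a finite poset is compact. -/
theorem isCompact_support_subset (F : Finset P) :
    IsCompact {t : OrderComplex P | t.coord.support ⊆ F} := by
  have h : {t : OrderComplex P | t.coord.support ⊆ F} =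
      ⋃ c ∈ {c : Finset P | c ⊆ F ∧ IsChain (· ≤ ·) (c : Set P)}, simplex c := by
    ext t
    simp only [mem_ofPred_eq, mem_iUnion, exists_prop, simplex]
    exact ⟨fun h => ⟨_, ⟨h, t.isChain_support⟩, subset_rfl⟩, fun ⟨c, hc, h⟩ => h.trans hc.1⟩
  rw [h]
  refine Set.Finite.isCompact_biUnion ?_ fun c hc => isCompact_simplex hc.2
  exact F.powerset.finite_toSet.subset fun c hc => Finset.mem_coe.2 (Finset.mem_powerset.2 hc.1)

open Classical in
/-- The weight of `p` minus the weights of all elements of `F` that are incomparable to `p`. -/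
noncomputable def chainPart (F : Finset P) (b : P → ℝ) (p : P) : ℝ :=
  max 0 (b p - ∑ q ∈ F.filter fun q => ¬ (p ≤ q ∨ q ≤ p), b q)

theorem chainPart_nonneg (F : Finset P) (b : P → ℝ) (p : P) : 0 ≤ chainPart F b p :=
  le_max_left _ _

theorem chainPart_le {F : Finset P} {b : P → ℝ} (hb : ∀ q ∈ F, 0 ≤ b q) {p : P} (hp : p ∈ F) :
    chainPart F b p ≤ b p := by
  classical
  exact max_le (hb p hp) (sub_le_self _ (Finset.sum_nonneg fun q hq => hb q (Finset.mem_filter.1 hq).1))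

/-- For incomparable `p` and `q`, a positive chain part at `p` forces `b q < b p`, and one at `q`
the reverse. So `chainPart` turns arbitrary nonnegative weights into weights supported on a chain.
-/
theorem comparable_of_chainPart_pos {F : Finset P} {b : P → ℝ} (hb : ∀ q ∈ F, 0 ≤ b q) {p q : P}
    (hp : p ∈ F) (hq : q ∈ F) (h1 : 0 < chainPart F b p) (h2 : 0 < chainPart F b q) :
    p ≤ q ∨ q ≤ p := by
  classical
  by_contra hpq
  have key : ∀ p ∈ F, ∀ q ∈ F, ¬ (p ≤ q ∨ q ≤ p) → 0 < chainPart F b p → b q < b p := by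
    intro p _ q hq hpq h1
    rw [chainPart, lt_max_iff] at h1
    have h3 : b q ≤ ∑ q ∈ F with ¬ (p ≤ q ∨ q ≤ p), b q :=
      Finset.single_le_sum (f := b) (fun r hr => hb r (Finset.mem_filter.1 hr).1)
        (Finset.mem_filter.2 ⟨hq, hpq⟩)
    rcases h1 with h1 | h1
    · exact absurd h1 (lt_irrefl _)
    · linarith
  exact lt_asymm (key p hp q hq hpq h1) (key q hq p hp (fun h => hpq h.symm) h2)

/-- Nothing is subtracted from a vertex of a chain, as all vertices incomparable to it have weight
zero. Hence `chainPart` acts as a retraction, and extensions corrected by it keep their prescribed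
values. -/
theorem chainPart_coord (F : Finset P) (t : OrderComplex P) (p : P) :
    chainPart F t.coord p = t.coord p := by
  classical
  have h0 : 0 ≤ ∑ q ∈ F with ¬ (p ≤ q ∨ q ≤ p), t.coord q :=
    Finset.sum_nonneg fun q _ => t.coord_nonneg q
  by_cases hp : t.coord p = 0
  · rw [chainPart, hp]
    exact max_eq_left (by linarith)
  · have hs : ∑ q ∈ F with ¬ (p ≤ q ∨ q ≤ p), t.coord q = 0 := by
      refine Finset.sum_eq_zero fun q hq => ?_
      by_contra hq0
      exact (Finset.mem_filter.1 hq).2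
        (t.isChain_support.total (Finsupp.mem_support_iff.2 hp) (Finsupp.mem_support_iff.2 hq0))
    rw [chainPart, hs, sub_zero]
    exact max_eq_right (t.coord_nonneg p)

/-- The order complex of a finite poset with a greatest element is an absolute extensor for normal
spaces. -/
theorem exists_extension_of_isGreatest {Y : Type*} [TopologicalSpace Y] [NormalSpace Y] {Z : Set Y}
    (hZ : IsClosed Z) {F : Finset P} {e : P} (he : IsGreatest (F : Set P) e)
    {s : Z → OrderComplex P} (hs : Continuous s) (hsF : ∀ z, (s z).coord.support ⊆ F) :
    ∃ S : Y → OrderComplex P, Continuous S ∧ (∀ y, (S y).coord.support ⊆ F) ∧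
      ∀ z : Z, S z = s z := by
  classical
  -- Tietze's theorem extends each coordinate separately; the extensions need be neither
  -- nonnegative, nor of sum 1, nor supported on chains.
  have ht : ∀ p : P, ∃ g : C(Y, ℝ), g.restrict Z = ⟨_, (continuous_coord p).comp hs⟩ :=
    fun p => ContinuousMap.exists_restrict_eq hZ _
  choose g hg using ht
  have hg' : ∀ p (z : Z), g p z = (s z).coord p := fun p z => DFunLike.congr_fun (hg p) z
  -- Clipping makes the weights nonnegative; the division makes the total weight outside `e` at most
  -- 1, and changes nothing where it already was.
  let a : P → Y → ℝ := fun p y => max 0 (g p y)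
  let b : Y → P → ℝ := fun y p => a p y / max 1 (∑ q ∈ F.erase e, a q y)
  have ha0 : ∀ p y, 0 ≤ a p y := fun p y => le_max_left _ _
  have hm : ∀ y, 0 < max 1 (∑ q ∈ F.erase e, a q y) := fun y => lt_max_of_lt_left one_pos
  have hb0 : ∀ y p, 0 ≤ b y p := fun y p => div_nonneg (ha0 p y) (hm y).le
  have hb1 : ∀ y, ∑ q ∈ F.erase e, b y q ≤ 1 := fun y => by
    simp only [b]
    rw [← Finset.sum_div, div_le_one (hm y)]
    exact le_max_right _ _
  have hac : ∀ p, Continuous (a p) := fun p => continuous_const.max (g p).continuous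
  have hbc : ∀ p, Continuous fun y => b y p := fun p =>
    (hac p).div (continuous_const.max (continuous_finsetSum _ fun q _ => hac q))
      fun y => (hm y).ne'
  -- The chain part is taken outside `e`, and `e` receives the missing weight. This keeps the
  -- support a chain since `e` is comparable to everything in `F`.
  let w : Y → P → ℝ := fun y p =>
    if p = e then 1 - ∑ q ∈ F.erase e, chainPart (F.erase e) (b y) q
    else chainPart (F.erase e) (b y) p
  have hcc : ∀ p, Continuous fun y => chainPart (F.erase e) (b y) p := fun p =>
    continuous_const.max ((hbc p).sub (continuous_finsetSum _ fun q _ => hbc q))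
  have hwc : ∀ p, Continuous fun y => w y p := by
    intro p
    by_cases hp : p = e
    · simp only [w, hp, if_true]
      exact continuous_const.sub (continuous_finsetSum _ fun q _ => hcc q)
    · simp only [w, hp, if_false]
      exact hcc p
  have hw0 : ∀ y p, 0 ≤ w y p := by
    intro y p
    simp only [w]
    split_ifs
    · have : ∑ q ∈ F.erase e, chainPart (F.erase e) (b y) q ≤ ∑ q ∈ F.erase e, b y q :=
        Finset.sum_le_sum fun q hq => chainPart_le (fun q _ => hb0 y q) hq
      linarith [hb1 y]
    · exact chainPart_nonneg _ _ _
  have hw1 : ∀ y, ∑ p ∈ F, w y p = 1 := by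
    intro y
    rw [← Finset.add_sum_erase F _ he.1]
    have : ∑ q ∈ F.erase e, w y q = ∑ q ∈ F.erase e, chainPart (F.erase e) (b y) q :=
      Finset.sum_congr rfl fun q hq => if_neg (Finset.ne_of_mem_erase hq)
    rw [this]
    simp [w]
  have hwF : ∀ y, ∀ p ∈ F, ∀ q ∈ F, 0 < w y p → 0 < w y q → p ≤ q ∨ q ≤ p := by
    intro y p hp q hq h1 h2
    by_cases hpe : p = e
    · exact Or.inr (hpe ▸ he.2 hq)
    by_cases hqe : q = e
    · exact Or.inl (hqe ▸ he.2 hp)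
    simp only [w, hpe, hqe, if_false] at h1 h2
    exact comparable_of_chainPart_pos (fun q _ => hb0 y q) (Finset.mem_erase.2 ⟨hpe, hp⟩)
      (Finset.mem_erase.2 ⟨hqe, hq⟩) h1 h2
  refine ⟨fun y => ofWeights F (w y) (fun p _ => hw0 y p) (hw1 y) (hwF y), ?_,
    fun y => support_ofWeights_subset, fun z => ?_⟩
  · refine continuous_of_coord F (fun y => support_ofWeights_subset) fun p => ?_
    by_cases hp : p ∈ F
    · simp only [ofWeights_coord_of_mem hp]
      exact hwc p
    · simp only [ofWeights_coord_of_notMem hp]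
      exact continuous_const
  · have haz : ∀ p, a p z = (s z).coord p := fun p => by
      simp only [a, hg']
      exact max_eq_right ((s z).coord_nonneg p)
    have hsum := (s z).sum_coord_of_subset (hsF z)
    rw [← Finset.add_sum_erase F _ he.1] at hsum
    have hbz : b z = (s z).coord := by
      funext p
      simp only [b, haz]
      rw [max_eq_left, div_one]
      linarith [(s z).coord_nonneg e]
    ext p
    by_cases hp : p ∈ F
    · rw [ofWeights_coord_of_mem hp]
      simp only [w, hbz, chainPart_coord]
      split_ifs with hpe
      · subst hpe
        linarith
      · rfl
    · rw [ofWeights_coord_of_notMem hp]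
      exact (Finsupp.notMem_support_iff.1 fun h => hp (hsF z h)).symm

end OrderComplex

/-! ### Extension of homotopies over the domain of a cell. -/

/-- `H` is a strong deformation retraction of `D` onto `B` that extends `h` on the part of `D` in
the unit sphere. -/
structure IsCellHomotopy {n : ℕ} (D B : Set (EuclideanSpace ℝ (Fin n)))
    (h H : EuclideanSpace ℝ (Fin n) → unitInterval → EuclideanSpace ℝ (Fin n)) : Prop where
  continuousOn : ContinuousOn (Function.uncurry H) (D ×ˢ univ)
  mapsTo : ∀ y ∈ D, ∀ t, H y t ∈ D
  start : ∀ y ∈ D, H y 0 = y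
  finish : ∀ y ∈ D, H y 1 ∈ B
  stationary : ∀ y ∈ B, ∀ t, H y t = y
  boundary : ∀ y ∈ D, ‖y‖ = 1 → ∀ t, H y t = h y t

open Classical in
/-- A chosen homotopy as in `IsCellHomotopy`, which depends on nothing but `D`, `B` and `h`. -/
noncomputable def cellHomotopy {n : ℕ} (D B : Set (EuclideanSpace ℝ (Fin n)))
    (h : EuclideanSpace ℝ (Fin n) → unitInterval → EuclideanSpace ℝ (Fin n)) :
    EuclideanSpace ℝ (Fin n) → unitInterval → EuclideanSpace ℝ (Fin n) :=
  if hH : ∃ H, IsCellHomotopy D B h H then hH.choose else fun y _ => y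

theorem cellHomotopy_spec {n : ℕ} {D B : Set (EuclideanSpace ℝ (Fin n))}
    {h : EuclideanSpace ℝ (Fin n) → unitInterval → EuclideanSpace ℝ (Fin n)}
    (hH : ∃ H, IsCellHomotopy D B h H) : IsCellHomotopy D B h (cellHomotopy D B h) := by
  rw [cellHomotopy, dif_pos hH]
  exact hH.choose_spec

/-- A set between the open and the closed unit ball is an absolute extensor for metric spaces. -/
theorem exists_extension_of_ball_subset {E : Type*} [NormedAddCommGroup E] [NormedSpace ℝ E]
    [FiniteDimensional ℝ E] {D : Set E} (hD1 : Metric.ball 0 1 ⊆ D)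
    (hD2 : D ⊆ Metric.closedBall 0 1) {Y : Type*} [PseudoMetricSpace Y] {Z : Set Y}
    (hZ : IsClosed Z) {g : Y → E} (hg : ContinuousOn g Z) (hgD : ∀ z ∈ Z, g z ∈ D) :
    ∃ G : Y → E, Continuous G ∧ (∀ y, G y ∈ D) ∧ ∀ z ∈ Z, G z = g z := by
  -- The distance to the empty set is 0 by convention, so the factor `r` below would not be less
  -- than 1.
  rcases Z.eq_empty_or_nonempty with rfl | hne
  · exact ⟨fun _ => 0, continuous_const, fun _ => hD1 (by simp), fun z hz => hz.elim⟩
  have := Set.instTietzeExtensionUnitClosedBall (𝕜 := ℝ) (E := E)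
  let g' : C(Z, Metric.closedBall (0 : E) 1) :=
    ⟨fun z => ⟨g z, hD2 (hgD z z.2)⟩, hg.domRestrict.subtype_mk _⟩
  obtain ⟨G, hG⟩ := ContinuousMap.exists_restrict_eq hZ g'
  have hG' : ∀ z (hz : z ∈ Z), (G z : E) = g z := fun z hz =>
    congrArg Subtype.val (DFunLike.congr_fun hG ⟨z, hz⟩)
  -- This factor is 1 on `Z` and less than 1 elsewhere: it pushes the Tietze extension `G` into the
  -- open ball off `Z`, away from the points of the sphere that `D` may lack.
  let r : Y → ℝ := fun y => 1 - min 1 (Metric.infDist y Z)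
  have hr0 : ∀ y, 0 ≤ r y := fun y => sub_nonneg.2 (min_le_left _ _)
  have hrZ : ∀ z ∈ Z, r z = 1 := fun z hz => by
    simp [r, Metric.infDist_zero_of_mem hz]
  refine ⟨fun y => r y • (G y : E), ?_, fun y => ?_, fun z hz => ?_⟩
  · exact (continuous_const.sub (continuous_const.min (Metric.continuous_infDist_pt Z))).smul
      (continuous_subtype_val.comp G.continuous)
  · by_cases hy : y ∈ Z
    · simp only [hrZ y hy, one_smul, hG' y hy]
      exact hgD y hy
    · refine hD1 ?_
      have h1 : 0 < Metric.infDist y Z := (hZ.notMem_iff_infDist_pos hne).1 hy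
      have h2 : r y < 1 := sub_lt_self _ (lt_min one_pos h1)
      have h3 : ‖(G y : E)‖ ≤ 1 := mem_closedBall_zero_iff.1 (G y).2
      rw [mem_ball_zero_iff, norm_smul, Real.norm_of_nonneg (hr0 y)]
      exact lt_of_le_of_lt (mul_le_of_le_one_right (hr0 y) h3) h2
  · simp only [hrZ z hz, one_smul, hG' z hz]

/-- An extension problem for maps from `D × [0, 1]` to `D`: the homotopy is prescribed on both ends,
over the sphere and over `B`. These four sets are closed and the prescriptions agree on overlaps, so
that `exists_extension_of_ball_subset` applies. -/
theorem exists_isCellHomotopy {n : ℕ} {D B : Set (EuclideanSpace ℝ (Fin n))}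
    (hD1 : Metric.ball 0 1 ⊆ D) (hD2 : D ⊆ Metric.closedBall 0 1) (hBD : B ⊆ D)
    (hB : IsClosed (Subtype.val ⁻¹' B : Set D))
    {h : EuclideanSpace ℝ (Fin n) → unitInterval → EuclideanSpace ℝ (Fin n)}
    (hc : ContinuousOn (Function.uncurry h) ((D ∩ {y | ‖y‖ = 1}) ×ˢ univ))
    (hm : ∀ y ∈ D, ‖y‖ = 1 → ∀ t, h y t ∈ D)
    (h0 : ∀ y ∈ D, ‖y‖ = 1 → h y 0 = y)
    (hs : ∀ y ∈ B, ‖y‖ = 1 → ∀ t, h y t = y)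
    {R : D → D} (hR : Continuous R) (hRB : ∀ y, (R y : EuclideanSpace ℝ (Fin n)) ∈ B)
    (hR1 : ∀ y : D, ‖(y : EuclideanSpace ℝ (Fin n))‖ = 1 → (R y : EuclideanSpace ℝ (Fin n)) = h y 1)
    (hRs : ∀ y : D, (y : EuclideanSpace ℝ (Fin n)) ∈ B → R y = y) :
    ∃ H, IsCellHomotopy D B h H := by
  classical
  let E := EuclideanSpace ℝ (Fin n)
  let g : D × unitInterval → E := fun z =>
    if z.2 = 0 then z.1 else if z.2 = 1 then R z.1 else if ‖(z.1 : E)‖ = 1 then h z.1 z.2 else z.1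
  let Z0 : Set (D × unitInterval) := {z | z.2 = 0}
  let Z1 : Set (D × unitInterval) := {z | z.2 = 1}
  let Zs : Set (D × unitInterval) := {z | ‖(z.1 : E)‖ = 1}
  let ZB : Set (D × unitInterval) := {z | (z.1 : E) ∈ B}
  have c0 : IsClosed Z0 := isClosed_eq continuous_snd continuous_const
  have c1 : IsClosed Z1 := isClosed_eq continuous_snd continuous_const
  have cs : IsClosed Zs := isClosed_eq
    (continuous_norm.comp (continuous_subtype_val.comp continuous_fst)) continuous_const
  have cB : IsClosed ZB := hB.preimage continuous_fst
  have hfst : Continuous fun z : D × unitInterval => (z.1 : E) :=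
    continuous_subtype_val.comp continuous_fst
  have g0 : ∀ z ∈ Z0, g z = z.1 := fun z hz => if_pos hz
  have g1 : ∀ z ∈ Z1, g z = R z.1 := fun z hz => by
    have hz' : z.2 = 1 := hz
    simp [g, hz']
  have gs : ∀ z ∈ Zs, g z = h z.1 z.2 := fun z hz => by
    have hz' : ‖(z.1 : E)‖ = 1 := hz
    simp only [g, hz', if_true]
    split_ifs with h1 h2
    · rw [h1, h0 z.1 z.1.2 hz']
    · rw [h2, hR1 z.1 hz']
    · rfl
  have gB : ∀ z ∈ ZB, g z = z.1 := fun z hz => by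
    have hz' : (z.1 : E) ∈ B := hz
    simp only [g, hRs z.1 hz']
    split_ifs with h1 h2 h3
    · rfl
    · rfl
    · exact hs z.1 hz' h3 _
    · rfl
  have hgc : ContinuousOn g (Z0 ∪ Z1 ∪ Zs ∪ ZB) := by
    refine ContinuousOn.union_of_isClosed (ContinuousOn.union_of_isClosed
      (ContinuousOn.union_of_isClosed ?_ ?_ c0 c1) ?_ (c0.union c1) cs) ?_
      ((c0.union c1).union cs) cB
    · exact hfst.continuousOn.congr g0
    · exact (continuous_subtype_val.comp (hR.comp continuous_fst)).continuousOn.congr g1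
    · refine ContinuousOn.congr ?_ gs
      exact hc.comp (hfst.prodMk continuous_snd).continuousOn
        fun z hz => ⟨⟨z.1.2, hz⟩, mem_univ _⟩
    · exact hfst.continuousOn.congr gB
  have hgD : ∀ z ∈ Z0 ∪ Z1 ∪ Zs ∪ ZB, g z ∈ D := by
    rintro z (((hz | hz) | hz) | hz)
    · rw [g0 z hz]; exact z.1.2
    · rw [g1 z hz]; exact (R z.1).2
    · rw [gs z hz]; exact hm _ z.1.2 hz _
    · rw [gB z hz]; exact z.1.2
  obtain ⟨G, hGc, hGD, hG⟩ := exists_extension_of_ball_subset hD1 hD2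
    (((c0.union c1).union cs).union cB) hgc hgD
  refine ⟨fun y t => if hy : y ∈ D then G (⟨y, hy⟩, t) else y, ?_, ?_, ?_, ?_, ?_, ?_⟩
  · rw [continuousOn_iff_continuous_domRestrict]
    have : Continuous fun z : (D ×ˢ univ : Set (E × unitInterval)) =>
        G (⟨z.1.1, z.2.1⟩, z.1.2) :=
      hGc.comp (((continuous_fst.comp continuous_subtype_val).subtype_mk _).prodMk
        (continuous_snd.comp continuous_subtype_val))
    refine this.congr fun z => ?_
    simp only [domRestrict_apply, Function.uncurry, dif_pos z.2.1]
  · intro y hy t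
    simp only [dif_pos hy]
    exact hGD _
  · intro y hy
    have hz : ((⟨y, hy⟩, 0) : D × unitInterval) ∈ Z0 := Eq.refl (0 : unitInterval)
    simp only [dif_pos hy]
    exact (hG _ (Or.inl (Or.inl (Or.inl hz)))).trans (g0 _ hz)
  · intro y hy
    have hz : ((⟨y, hy⟩, 1) : D × unitInterval) ∈ Z1 := Eq.refl (1 : unitInterval)
    simp only [dif_pos hy]
    rw [hG _ (Or.inl (Or.inl (Or.inr hz))), g1 _ hz]
    exact hRB _
  · intro y hy t
    have hz : ((⟨y, hBD hy⟩, t) : D × unitInterval) ∈ ZB := hy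
    simp only [dif_pos (hBD hy)]
    exact (hG _ (Or.inr hz)).trans (gB _ hz)
  · intro y hy h1 t
    have hz : ((⟨y, hy⟩, t) : D × unitInterval) ∈ Zs := h1
    simp only [dif_pos hy]
    exact (hG _ (Or.inl (Or.inr hz))).trans (gs _ hz)

/-! ### Characteristic maps as total functions, and the combinatorics of faces. -/

namespace CellularStratification

section Cells

variable {X : Type u} [TopologicalSpace X] (C : CellularStratification.{u, v} X) {n : ℕ}

theorem ball_subset_dom (e : C.cell n) : Metric.ball 0 1 ⊆ C.dom e :=
  (C.isStratification.isCell e).ball_subset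

theorem dom_subset_closedBall (e : C.cell n) : C.dom e ⊆ Metric.closedBall 0 1 :=
  (C.isStratification.isCell e).subset_closedBall

theorem zero_mem_dom (e : C.cell n) : (0 : EuclideanSpace ℝ (Fin n)) ∈ C.dom e :=
  C.ball_subset_dom e (by simp)

variable {C} in
theorem norm_le_one {e : C.cell n} {y : EuclideanSpace ℝ (Fin n)} (hy : y ∈ C.dom e) :
    ‖y‖ ≤ 1 :=
  mem_closedBall_zero_iff.1 (C.dom_subset_closedBall e hy)

theorem smul_mem_dom (e : C.cell n) {y : EuclideanSpace ℝ (Fin n)} (hy : y ∈ C.dom e) {r : ℝ}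
    (h0 : 0 ≤ r) (h1 : r ≤ 1) : r • y ∈ C.dom e := by
  rcases h1.eq_or_lt with rfl | h1
  · rwa [one_smul]
  · refine C.ball_subset_dom e ?_
    rw [mem_ball_zero_iff, norm_smul, Real.norm_of_nonneg h0]
    exact lt_of_le_of_lt (mul_le_of_le_one_right h0 (norm_le_one hy)) h1

open Classical in
/-- The characteristic map, extended to the whole Euclidean space by a constant. -/
noncomputable def charExt (e : C.cell n) (y : EuclideanSpace ℝ (Fin n)) : X :=
  if h : y ∈ C.dom e then C.char e ⟨y, h⟩ else C.char e ⟨0, C.zero_mem_dom e⟩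

theorem charExt_of_mem {e : C.cell n} {y : EuclideanSpace ℝ (Fin n)} (h : y ∈ C.dom e) :
    C.charExt e y = C.char e ⟨y, h⟩ :=
  dif_pos h

open Classical in
/-- The inverse of the characteristic map on the closure of the cell, extended by zero. -/
noncomputable def charInv (e : C.cell n) (x : X) : EuclideanSpace ℝ (Fin n) :=
  if h : ∃ y ∈ C.dom e, C.charExt e y = x then h.choose else 0

theorem charInv_mem_dom (e : C.cell n) (x : X) : C.charInv e x ∈ C.dom e := by
  rw [charInv]
  split_ifs with h
  exacts [h.choose_spec.1, C.zero_mem_dom e]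

theorem norm_charInv_le (e : C.cell n) (x : X) : ‖C.charInv e x‖ ≤ 1 :=
  norm_le_one (C.charInv_mem_dom e x)

theorem charExt_mem_closure {e : C.cell n} {y : EuclideanSpace ℝ (Fin n)} (h : y ∈ C.dom e) :
    C.charExt e y ∈ closure (C.carrier e) := by
  rw [C.charExt_of_mem h, ← (C.isStratification.isCell e).range_char]
  exact mem_range_self _

theorem charExt_mem_carrier {e : C.cell n} {y : EuclideanSpace ℝ (Fin n)} (h : ‖y‖ < 1) :
    C.charExt e y ∈ C.carrier e := by
  have hy : y ∈ Metric.ball (0 : EuclideanSpace ℝ (Fin n)) 1 := mem_ball_zero_iff.2 h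
  have h2 := (C.isStratification.isCell e).range_ball
  rw [C.charExt_of_mem (C.ball_subset_dom e hy)]
  exact h2.subset ⟨⟨y, hy⟩, rfl⟩

theorem charExt_charInv {e : C.cell n} {x : X} (hx : x ∈ closure (C.carrier e)) :
    C.charExt e (C.charInv e x) = x := by
  have h : ∃ y ∈ C.dom e, C.charExt e y = x := by
    rw [← (C.isStratification.isCell e).range_char] at hx
    obtain ⟨y, rfl⟩ := hx
    exact ⟨y, y.2, C.charExt_of_mem y.2⟩
  rw [charInv, dif_pos h]
  exact h.choose_spec.2

theorem continuousOn_charExt (e : C.cell n) : ContinuousOn (C.charExt e) (C.dom e) := by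
  rw [continuousOn_iff_continuous_domRestrict]
  exact (C.isStratification.isCell e).continuous_char.congr fun y => (C.charExt_of_mem y.2).symm

variable {C}

theorem charInv_charExt (hr : C.IsRegular) {e : C.cell n} {y : EuclideanSpace ℝ (Fin n)}
    (h : y ∈ C.dom e) : C.charInv e (C.charExt e y) = y := by
  have h1 := C.charExt_charInv (C.charExt_mem_closure h)
  rw [C.charExt_of_mem (C.charInv_mem_dom e _), C.charExt_of_mem h] at h1
  have h2 := congrArg Subtype.val ((hr e).injective h1)
  rwa [← C.charExt_of_mem h] at h2

theorem continuousOn_charInv (hr : C.IsRegular) (e : C.cell n) :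
    ContinuousOn (C.charInv e) (closure (C.carrier e)) := by
  rw [continuousOn_iff_continuous_domRestrict]
  have h : Continuous fun x : closure (C.carrier e) =>
      (⟨C.charInv e x, C.charInv_mem_dom e x⟩ : C.dom e) := by
    rw [(hr e).isInducing.continuous_iff]
    refine continuous_subtype_val.congr fun x => ?_
    rw [Function.comp_apply, ← C.charExt_of_mem, C.charExt_charInv x.2]
  exact continuous_subtype_val.comp h

theorem norm_lt_one_of_charExt_mem (hr : C.IsRegular) {e : C.cell n}
    {y : EuclideanSpace ℝ (Fin n)} (hy : y ∈ C.dom e) (h : C.charExt e y ∈ C.carrier e) :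
    ‖y‖ < 1 := by
  have h2 := (C.isStratification.isCell e).range_ball
  rw [← h2] at h
  obtain ⟨z, hz⟩ := h
  rw [C.charExt_of_mem hy] at hz
  have h3 := congrArg Subtype.val ((hr e).injective hz)
  simp only at h3
  rw [← h3]
  exact mem_ball_zero_iff.1 z.2

theorem norm_charInv_lt_one (hr : C.IsRegular) {e : C.cell n} {x : X} (hx : x ∈ C.carrier e) :
    ‖C.charInv e x‖ < 1 :=
  norm_lt_one_of_charExt_mem hr (C.charInv_mem_dom e x)
    (by rwa [C.charExt_charInv (subset_closure hx)])

theorem norm_charInv_eq_one {e : C.cell n} {x : X} (hx : x ∈ C.bdry e) :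
    ‖C.charInv e x‖ = 1 := by
  refine (C.norm_charInv_le e x).eq_of_not_lt fun h => hx.2 ?_
  rw [← C.charExt_charInv hx.1]
  exact C.charExt_mem_carrier h

theorem charExt_mem_bdry (hr : C.IsRegular) {e : C.cell n} {y : EuclideanSpace ℝ (Fin n)}
    (hy : y ∈ C.dom e) (h : ‖y‖ = 1) : C.charExt e y ∈ C.bdry e :=
  ⟨C.charExt_mem_closure hy, fun h2 => (norm_lt_one_of_charExt_mem hr hy h2).ne h⟩

end Cells

section Faces

variable {X : Type u} [TopologicalSpace X] {C : CellularStratification.{u, v} X}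

theorem dim_lt_of_lt {p q : C.FacePoset} (h : p < q) : p.1 < q.1 :=
  C.dim_lt_of_subset p q h.ne h.le

theorem face_eq_of_mem {p q : C.FacePoset} {x : X} (hp : x ∈ C.carrier p.2)
    (hq : x ∈ C.carrier q.2) : p = q := by
  by_contra h
  exact disjoint_left.1 (C.isStratification.disjoint h) hp hq

theorem closure_mono_of_le {p q : C.FacePoset} (h : p ≤ q) :
    closure (C.carrier p.2) ⊆ closure (C.carrier q.2) :=
  closure_minimal h isClosed_closure

/-- By normality `∂q` is a union of cells, and cells are disjoint; so it contains each cell that it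
meets. -/
theorem face_le_of_mem (hN : C.IsNormal) {p q : C.FacePoset} {x : X} (hp : x ∈ C.carrier p.2)
    (hq : x ∈ closure (C.carrier q.2)) : p ≤ q := by
  by_cases h : x ∈ C.carrier q.2
  · exact (face_eq_of_mem hp h).le
  · obtain ⟨S, -, -, hS⟩ := hN q.2
    have hx : x ∈ C.bdry q.2 := ⟨hq, h⟩
    rw [hS] at hx
    obtain ⟨s, hs, hxs⟩ := mem_iUnion₂.1 hx
    have hps : p = s := face_eq_of_mem hp hxs
    have h2 : C.carrier s.2 ⊆ C.bdry q.2 := by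
      rw [hS]
      exact subset_biUnion_of_mem (u := fun s : Σ m, C.cell m => C.carrier s.2) hs
    rw [hps]
    exact h2.trans sdiff_subset

theorem disjoint_carrier_closure_of_lt {p q : C.FacePoset} (h : p < q) :
    Disjoint (closure (C.carrier p.2)) (C.carrier q.2) := by
  rw [disjoint_left]
  intro x hx hxq
  obtain ⟨S, -, hS, hcov⟩ := C.isStratification.closure_finite p.2
  by_cases hxp : x ∈ C.carrier p.2
  · exact h.ne (face_eq_of_mem hxp hxq)
  · obtain ⟨s, hs, hxs⟩ := mem_iUnion₂.1 (hcov ⟨hx, hxp⟩)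
    have hqs : q = s := face_eq_of_mem hxq hxs
    have h1 := hS s hs
    rw [← hqs] at h1
    exact lt_asymm h1 (dim_lt_of_lt h)

theorem closure_subset_bdry_of_lt {p q : C.FacePoset} (h : p < q) :
    closure (C.carrier p.2) ⊆ C.bdry q.2 := fun _ hx =>
  ⟨closure_mono_of_le h.le hx, disjoint_left.1 (disjoint_carrier_closure_of_lt h) hx⟩

theorem finite_Iic (hN : C.IsNormal) (q : C.FacePoset) : (Iic q).Finite := by
  obtain ⟨S, hSf, -, hS⟩ := hN q.2
  refine (hSf.insert (q : Σ n, C.cell n)).subset fun p hp => ?_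
  by_cases hpq : p = q
  · exact Or.inl hpq
  · obtain ⟨x, hx⟩ := C.carrier_nonempty p.2
    have hxb : x ∈ C.bdry q.2 :=
      closure_subset_bdry_of_lt (lt_of_le_of_ne hp hpq) (subset_closure hx)
    rw [hS] at hxb
    obtain ⟨s, hs, hxs⟩ := mem_iUnion₂.1 hxb
    have hps : p = s := face_eq_of_mem hx hxs
    exact Or.inr (hps ▸ hs)

variable (C) in
theorem exists_face_mem (x : X) : ∃ p : C.FacePoset, x ∈ C.carrier p.2 := by
  have hx : x ∈ ⋃ n, C.stratum n := C.isStratification.cover ▸ mem_univ x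
  obtain ⟨n, hx⟩ := mem_iUnion.1 hx
  obtain ⟨e, he⟩ := mem_iUnion.1 hx
  exact ⟨⟨n, e⟩, he⟩

variable (C) in
/-- The cell that contains a point. -/
noncomputable def cellOf (x : X) : C.FacePoset := (C.exists_face_mem x).choose

variable (C) in
theorem mem_cellOf (x : X) : x ∈ C.carrier (C.cellOf x).2 := (C.exists_face_mem x).choose_spec

theorem cellOf_eq {p : C.FacePoset} {x : X} (hx : x ∈ C.carrier p.2) : C.cellOf x = p :=
  face_eq_of_mem (C.mem_cellOf x) hx

theorem cellOf_lt (hN : C.IsNormal) {p : C.FacePoset} {x : X} (hx : x ∈ C.bdry p.2) :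
    C.cellOf x < p := by
  refine lt_of_le_of_ne (face_le_of_mem hN (C.mem_cellOf x) hx.1) fun h => hx.2 ?_
  rw [← h]
  exact C.mem_cellOf x

theorem bdry_eq_biUnion (hN : C.IsNormal) (q : C.FacePoset) :
    C.bdry q.2 = ⋃ p ∈ Iio q, closure (C.carrier p.2) := by
  refine Subset.antisymm (fun x hx => ?_) (iUnion₂_subset fun p hp => closure_subset_bdry_of_lt hp)
  exact mem_biUnion (cellOf_lt hN hx) (subset_closure (C.mem_cellOf x))

/-- A compact subset of the closure of a cell is closed, although the space need not be
Hausdorff. -/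
theorem isClosed_of_isCompact (hr : C.IsRegular) {p : C.FacePoset} {K : Set X} (hK : IsCompact K)
    (h : K ⊆ closure (C.carrier p.2)) : IsClosed K := by
  -- The coordinates `charInv` map the closure of the cell injectively and continuously to a
  -- Euclidean space.
  have hT : T2Space (closure (C.carrier p.2)) := by
    refine T2Space.of_injective_continuous (f := fun x => C.charInv p.2 x.1) (fun x y hxy => ?_)
      (continuousOn_iff_continuous_domRestrict.1 (continuousOn_charInv hr p.2))
    have h := congrArg (C.charExt p.2) hxy
    simp only [C.charExt_charInv x.2, C.charExt_charInv y.2] at h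
    exact Subtype.ext h
  have h1 : (Subtype.val '' (Subtype.val ⁻¹' K : Set (closure (C.carrier p.2)))) = K := by
    rw [Subtype.image_preimage_coe, inter_eq_right.2 h]
  have h2 : IsCompact (Subtype.val ⁻¹' K : Set (closure (C.carrier p.2))) := by
    rw [IsEmbedding.subtypeVal.isCompact_iff, h1]
    exact hK
  rw [← h1]
  exact isClosed_closure.isClosedEmbedding_subtypeVal.isClosedMap _ h2.isClosed

end Faces

end CellularStratification

theorem exists_isGreatest_of_isChain {P : Type*} [PartialOrder P] {c : Finset P}
    (hc : IsChain (· ≤ ·) (c : Set P)) (h : c.Nonempty) : ∃ e, IsGreatest (c : Set P) e := by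
  obtain ⟨e, he⟩ := c.exists_maximal h
  refine ⟨e, he.1, fun p hp => ?_⟩
  rcases hc.total hp he.1 with h | h
  exacts [h, he.2 hp h]

/-! ### Points of `X` with given barycentric coordinates. -/

namespace CellularStratification

variable {X : Type u} [TopologicalSpace X] (C : CellularStratification.{u, v} X)

open Classical in
/-- The point with (homogeneous) barycentric coordinates `t p` for `p` in a chain `c` of cells: in
coordinates of the largest cell `e` of `c`, it is the point that divides the segment from the
centre to the point given by `c \ {e}` in the proper ratio. -/
noncomputable def realize [Nonempty X] (c : Finset C.FacePoset) (t : C.FacePoset → ℝ) : X :=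
  if h : ∃ e, IsGreatest (c : Set C.FacePoset) e then
    C.charExt h.choose.2 (((∑ p ∈ c.erase h.choose, t p) / ∑ p ∈ c, t p) •
      C.charInv h.choose.2 (realize (c.erase h.choose) t))
  -- This value is also used when `c` has one element and the erased chain is empty. It has no
  -- influence there: the ratio is 0, and the result is the centre of the cell.
  else Classical.arbitrary X
termination_by c.card
decreasing_by exact Finset.card_erase_lt_of_mem h.choose_spec.1

/-- The ratio that occurs in `realize`. -/
noncomputable def ratio {P : Type*} [DecidableEq P] (c : Finset P) (e : P) (t : P → ℝ) : ℝ :=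
  (∑ p ∈ c.erase e, t p) / ∑ p ∈ c, t p

open Classical in
theorem realize_eq [Nonempty X] {c : Finset C.FacePoset} {e : C.FacePoset}
    (he : IsGreatest (c : Set C.FacePoset) e) (t : C.FacePoset → ℝ) :
    C.realize c t = C.charExt e.2 (ratio c e t • C.charInv e.2 (C.realize (c.erase e) t)) := by
  have h : ∃ e, IsGreatest (c : Set C.FacePoset) e := ⟨e, he⟩
  have h2 : h.choose = e := h.choose_spec.unique he
  rw [realize, dif_pos h, h2, ratio]

section ratio

variable {P : Type*} [DecidableEq P] {c : Finset P} {e : P} {t : P → ℝ}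

theorem ratio_nonneg (h : ∀ p ∈ c, 0 ≤ t p) : 0 ≤ ratio c e t :=
  div_nonneg (Finset.sum_nonneg fun p hp => h p (Finset.mem_of_mem_erase hp)) (Finset.sum_nonneg h)

theorem ratio_le_one (h : ∀ p ∈ c, 0 ≤ t p) : ratio c e t ≤ 1 :=
  div_le_one_of_le₀ (Finset.sum_le_sum_of_subset_of_nonneg (Finset.erase_subset _ _)
    fun p hp _ => h p hp) (Finset.sum_nonneg h)

theorem ratio_lt_one (h : ∀ p ∈ c, 0 ≤ t p) (he : e ∈ c) (hte : 0 < t e) : ratio c e t < 1 := by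
  have h1 := Finset.add_sum_erase c t he
  have h2 : 0 ≤ ∑ p ∈ c.erase e, t p :=
    Finset.sum_nonneg fun p hp => h p (Finset.mem_of_mem_erase hp)
  rw [ratio, div_lt_one (by linarith)]
  linarith

theorem ratio_eq_one (he : e ∈ c) (hte : t e = 0) (hpos : 0 < ∑ p ∈ c, t p) :
    ratio c e t = 1 := by
  have h1 := Finset.add_sum_erase c t he
  rw [hte, zero_add] at h1
  rw [ratio, h1, div_self hpos.ne']

end ratio

variable {C}

theorem isChain_erase {P : Type*} [PartialOrder P] [DecidableEq P] {c : Finset P}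
    (hc : IsChain (· ≤ ·) (c : Set P)) (e : P) : IsChain (· ≤ ·) (c.erase e : Set P) :=
  hc.mono (Finset.coe_subset.2 (Finset.erase_subset e c))

theorem lt_of_isGreatest_erase {P : Type*} [PartialOrder P] [DecidableEq P] {c : Finset P}
    {e p : P} (he : IsGreatest (c : Set P) e) (hp : p ∈ c.erase e) : p < e :=
  lt_of_le_of_ne (he.2 (Finset.mem_of_mem_erase hp)) (Finset.ne_of_mem_erase hp)

section

variable [Nonempty X] {c : Finset C.FacePoset} {e : C.FacePoset} {t : C.FacePoset → ℝ}

theorem realize_mem_closure (he : IsGreatest (c : Set C.FacePoset) e) (h0 : ∀ p ∈ c, 0 ≤ t p) :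
    C.realize c t ∈ closure (C.carrier e.2) := by
  classical
  rw [C.realize_eq he]
  exact C.charExt_mem_closure
    (C.smul_mem_dom _ (C.charInv_mem_dom _ _) (ratio_nonneg h0) (ratio_le_one h0))

theorem realize_mem_carrier (he : IsGreatest (c : Set C.FacePoset) e) (h0 : ∀ p ∈ c, 0 ≤ t p)
    (hte : 0 < t e) : C.realize c t ∈ C.carrier e.2 := by
  classical
  rw [C.realize_eq he]
  refine C.charExt_mem_carrier ?_
  rw [norm_smul, Real.norm_of_nonneg (ratio_nonneg h0)]
  exact (mul_le_of_le_one_right (ratio_nonneg h0) (C.norm_charInv_le _ _)).trans_lt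
    (ratio_lt_one h0 he.1 hte)

theorem realize_erase_mem_bdry [DecidableEq C.FacePoset] (hc : IsChain (· ≤ ·) (c : Set C.FacePoset))
    (he : IsGreatest (c : Set C.FacePoset) e) (h0 : ∀ p ∈ c, 0 ≤ t p)
    (hne : (c.erase e).Nonempty) : C.realize (c.erase e) t ∈ C.bdry e.2 := by
  obtain ⟨e', he'⟩ := exists_isGreatest_of_isChain (isChain_erase hc e) hne
  exact closure_subset_bdry_of_lt (lt_of_isGreatest_erase he he'.1)
    (realize_mem_closure he' fun p hp => h0 p (Finset.mem_of_mem_erase hp))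

theorem realize_smul (c : Finset C.FacePoset) {t t' : C.FacePoset → ℝ} {a : ℝ} (ha : a ≠ 0)
    (h : ∀ p ∈ c, t' p = a * t p) : C.realize c t' = C.realize c t := by
  classical
  induction c using Finset.strongInduction with
  | H c ih =>
    by_cases hg : ∃ e, IsGreatest (c : Set C.FacePoset) e
    · obtain ⟨e, he⟩ := hg
      rw [C.realize_eq he, C.realize_eq he, ih _ (Finset.erase_ssubset he.1)
        fun p hp => h p (Finset.mem_of_mem_erase hp)]
      congr 2
      rw [ratio, ratio, Finset.sum_congr rfl h,
        Finset.sum_congr rfl fun p hp => h p (Finset.mem_of_mem_erase hp), ← Finset.mul_sum,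
        ← Finset.mul_sum, mul_div_mul_left _ _ ha]
    · rw [realize, realize, dif_neg hg, dif_neg hg]

/-- If the greatest cell has weight zero, the ratio is 1 and coning leaves the boundary point where
it is; otherwise the cells to drop lie below it. This makes the formulas on a simplex and on its
faces compatible. -/
theorem realize_of_subset (c : Finset C.FacePoset) {c' : Finset C.FacePoset}
    (hc : IsChain (· ≤ ·) (c : Set C.FacePoset)) (h0 : ∀ p ∈ c, 0 ≤ t p)
    (hpos : 0 < ∑ p ∈ c, t p) (hsub : c' ⊆ c) (hz : ∀ p ∈ c, p ∉ c' → t p = 0) :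
    C.realize c t = C.realize c' t := by
  classical
  induction c using Finset.strongInduction generalizing c' with
  | H c ih =>
    have hne : c.Nonempty := by
      by_contra h
      rw [Finset.not_nonempty_iff_eq_empty.1 h, Finset.sum_empty] at hpos
      exact lt_irrefl _ hpos
    have hsum : ∑ p ∈ c', t p = ∑ p ∈ c, t p := Finset.sum_subset hsub hz
    obtain ⟨e, he⟩ := exists_isGreatest_of_isChain hc hne
    have h0' : ∀ p ∈ c.erase e, 0 ≤ t p := fun p hp => h0 p (Finset.mem_of_mem_erase hp)
    have hadd := Finset.add_sum_erase c t he.1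
    by_cases hec : e ∈ c'
    · have he' : IsGreatest (c' : Set C.FacePoset) e := ⟨hec, fun p hp => he.2 (hsub hp)⟩
      have hadd' := Finset.add_sum_erase c' t hec
      have hr : ratio c e t = ratio c' e t := by
        rw [ratio, ratio, hsum]
        congr 1
        linarith
      rw [C.realize_eq he, C.realize_eq he', ← hr]
      by_cases hs : 0 < ∑ p ∈ c.erase e, t p
      · rw [ih _ (Finset.erase_ssubset he.1) (isChain_erase hc e) h0' hs
          (Finset.erase_subset_erase e hsub) fun p hp hp' => hz p (Finset.mem_of_mem_erase hp)
            fun h => hp' (Finset.mem_erase.2 ⟨Finset.ne_of_mem_erase hp, h⟩)]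
      · have h1 : ∑ p ∈ c.erase e, t p = 0 :=
          le_antisymm (not_lt.1 hs) (Finset.sum_nonneg h0')
        rw [ratio, h1, zero_div, zero_smul, zero_smul]
    · have hte := hz e he.1 hec
      have hs : 0 < ∑ p ∈ c.erase e, t p := by linarith
      have hne' : (c.erase e).Nonempty := Finset.nonempty_of_sum_ne_zero hs.ne'
      rw [C.realize_eq he, ratio_eq_one he.1 hte hpos, one_smul,
        C.charExt_charInv (realize_erase_mem_bdry hc he h0 hne').1]
      refine ih _ (Finset.erase_ssubset he.1) (isChain_erase hc e) h0' hs
        (fun p hp => Finset.mem_erase.2 ⟨fun h => hec (h ▸ hp), hsub hp⟩)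
        fun p hp hp' => hz p (Finset.mem_of_mem_erase hp) hp'

theorem continuousOn_realize (hr : C.IsRegular) (c : Finset C.FacePoset)
    (hc : IsChain (· ≤ ·) (c : Set C.FacePoset)) :
    ContinuousOn (C.realize c) {t | (∀ p ∈ c, 0 ≤ t p) ∧ 0 < ∑ p ∈ c, t p} := by
  classical
  induction c using Finset.strongInduction with
  | H c ih =>
    rcases c.eq_empty_or_nonempty with rfl | hne
    · rintro t ⟨-, ht⟩
      simp at ht
    obtain ⟨e, he⟩ := exists_isGreatest_of_isChain hc hne
    have hsum : ∀ c : Finset C.FacePoset, Continuous fun t : C.FacePoset → ℝ => ∑ p ∈ c, t p :=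
      fun c => continuous_finsetSum _ fun p _ => continuous_apply p
    have hrat : ContinuousOn (ratio c e) {t | (∀ p ∈ c, 0 ≤ t p) ∧ 0 < ∑ p ∈ c, t p} :=
      (hsum _).continuousOn.div (hsum _).continuousOn fun t ht => ht.2.ne'
    have hV : ContinuousOn (fun t => ratio c e t • C.charInv e.2 (C.realize (c.erase e) t))
        {t | (∀ p ∈ c, 0 ≤ t p) ∧ 0 < ∑ p ∈ c, t p} := by
      rintro t ⟨h0, hpos⟩
      have h0' : ∀ p ∈ c.erase e, 0 ≤ t p := fun p hp => h0 p (Finset.mem_of_mem_erase hp)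
      by_cases hs : 0 < ∑ p ∈ c.erase e, t p
      · have hne' : (c.erase e).Nonempty := Finset.nonempty_of_sum_ne_zero hs.ne'
        refine (hrat t ⟨h0, hpos⟩).smul ?_
        have h1 : ContinuousOn (fun t => C.charInv e.2 (C.realize (c.erase e) t))
            {t | (∀ p ∈ c, 0 ≤ t p) ∧ 0 < ∑ p ∈ c.erase e, t p} := by
          refine (continuousOn_charInv hr e.2).comp
            ((ih _ (Finset.erase_ssubset he.1) (isChain_erase hc e)).mono ?_) ?_
          · exact fun t ht => ⟨fun p hp => ht.1 p (Finset.mem_of_mem_erase hp), ht.2⟩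
          · exact fun t ht => (realize_erase_mem_bdry hc he ht.1 hne').1
        -- Positive weight below `e`, which the induction hypothesis requires, is an open condition.
        refine (h1 t ⟨h0, hs⟩).mono_of_mem_nhdsWithin ?_
        have h2 : {t : C.FacePoset → ℝ | 0 < ∑ p ∈ c.erase e, t p} ∈ 𝓝 t :=
          (isOpen_lt continuous_const (hsum _)).mem_nhds hs
        filter_upwards [self_mem_nhdsWithin, mem_nhdsWithin_of_mem_nhds h2] with s hs1 hs2
        exact ⟨hs1.1, hs2⟩
      -- Where all weight is on `e`, the boundary point need not converge, but its coordinates are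
      -- bounded by 1 and the ratio tends to 0.
      · have h1 : ∑ p ∈ c.erase e, t p = 0 :=
          le_antisymm (not_lt.1 hs) (Finset.sum_nonneg h0')
        have h2 : ratio c e t = 0 := by rw [ratio, h1, zero_div]
        rw [ContinuousWithinAt, h2, zero_smul]
        have h3 := hrat t ⟨h0, hpos⟩
        rw [ContinuousWithinAt, h2] at h3
        refine squeeze_zero_norm' ?_ h3
        filter_upwards [self_mem_nhdsWithin] with s hs
        rw [norm_smul, Real.norm_of_nonneg (ratio_nonneg hs.1)]
        exact mul_le_of_le_one_right (ratio_nonneg hs.1) (C.norm_charInv_le _ _)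
    refine ((C.continuousOn_charExt e.2).comp hV fun t ht => ?_).congr fun t _ =>
      C.realize_eq he t
    exact C.smul_mem_dom _ (C.charInv_mem_dom _ _) (ratio_nonneg ht.1) (ratio_le_one ht.1)

/-- The cell that contains the point is the greatest element of the chain. In its coordinates the
norm is the ratio and the direction gives the boundary point, to which induction applies. Weights
are homogeneous, hence recovered only up to a common factor. -/
theorem realize_injective (hr : C.IsRegular) (c : Finset C.FacePoset) {c' : Finset C.FacePoset}
    {t t' : C.FacePoset → ℝ} (hc : IsChain (· ≤ ·) (c : Set C.FacePoset))
    (hc' : IsChain (· ≤ ·) (c' : Set C.FacePoset)) (hne : c.Nonempty) (hne' : c'.Nonempty)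
    (h0 : ∀ p ∈ c, 0 < t p) (h0' : ∀ p ∈ c', 0 < t' p)
    (h : C.realize c t = C.realize c' t') :
    c = c' ∧ ∀ p ∈ c, t p * ∑ q ∈ c', t' q = t' p * ∑ q ∈ c, t q := by
  classical
  induction c using Finset.strongInduction generalizing c' with
  | H c ih =>
    have hn : ∀ p ∈ c, 0 ≤ t p := fun p hp => (h0 p hp).le
    have hn' : ∀ p ∈ c', 0 ≤ t' p := fun p hp => (h0' p hp).le
    obtain ⟨e, he⟩ := exists_isGreatest_of_isChain hc hne
    obtain ⟨e', he'⟩ := exists_isGreatest_of_isChain hc' hne'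
    have hee : e' = e := by
      refine face_eq_of_mem (realize_mem_carrier he' hn' (h0' _ he'.1)) ?_
      rw [← h]
      exact realize_mem_carrier he hn (h0 _ he.1)
    subst hee
    have hadd := Finset.add_sum_erase c t he.1
    have hadd' := Finset.add_sum_erase c' t' he'.1
    have hte := h0 _ he.1
    have hte' := h0' _ he'.1
    have hp : ∀ p ∈ c.erase e', 0 < t p := fun p hp => h0 p (Finset.mem_of_mem_erase hp)
    have hp' : ∀ p ∈ c'.erase e', 0 < t' p := fun p hp => h0' p (Finset.mem_of_mem_erase hp)
    have hV : ratio c e' t • C.charInv e'.2 (C.realize (c.erase e') t) =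
        ratio c' e' t' • C.charInv e'.2 (C.realize (c'.erase e') t') := by
      rw [C.realize_eq he, C.realize_eq he'] at h
      have h2 := congrArg (C.charInv e'.2) h
      rwa [charInv_charExt hr (C.smul_mem_dom _ (C.charInv_mem_dom _ _) (ratio_nonneg hn)
          (ratio_le_one hn)), charInv_charExt hr (C.smul_mem_dom _ (C.charInv_mem_dom _ _)
          (ratio_nonneg hn') (ratio_le_one hn'))] at h2
    have hN := congrArg norm hV
    rw [norm_smul, norm_smul, Real.norm_of_nonneg (ratio_nonneg hn),
      Real.norm_of_nonneg (ratio_nonneg hn')] at hN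
    have hpos : ∀ {d : Finset C.FacePoset} {s : C.FacePoset → ℝ}, (∀ p ∈ d, 0 < s p) →
        (d.erase e').Nonempty → 0 < ratio d e' s := fun {d s} hd h =>
      div_pos (Finset.sum_pos (fun p hp => hd p (Finset.mem_of_mem_erase hp)) h)
        (Finset.sum_pos hd (h.mono (Finset.erase_subset _ _)))
    have hzero : ∀ {d : Finset C.FacePoset} {s : C.FacePoset → ℝ}, d.erase e' = ∅ →
        -- A vanishing norm thus tells a chain that consists of `e'` alone from a longer one, which
        -- rules out the mixed cases below.
        ratio d e' s = 0 := fun {d s} h => by rw [ratio, h, Finset.sum_empty, zero_div]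
    rcases (c.erase e').eq_empty_or_nonempty with hE | hE
    · rcases (c'.erase e').eq_empty_or_nonempty with hE' | hE'
      · have h1 : c = {e'} := by rw [← Finset.insert_erase he.1, hE]; rfl
        have h2 : c' = {e'} := by rw [← Finset.insert_erase he'.1, hE']; rfl
        refine ⟨h1.trans h2.symm, fun p hp => ?_⟩
        rw [h1, h2, Finset.sum_singleton, Finset.sum_singleton]
        rw [h1, Finset.mem_singleton] at hp
        rw [hp, mul_comm]
      · rw [hzero hE, zero_mul, norm_charInv_eq_one (realize_erase_mem_bdry hc' he' hn' hE'),
          mul_one] at hN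
        exact absurd hN (hpos h0' hE').ne
    · rcases (c'.erase e').eq_empty_or_nonempty with hE' | hE'
      · rw [hzero hE', zero_mul, norm_charInv_eq_one (realize_erase_mem_bdry hc he hn hE),
          mul_one] at hN
        exact absurd hN (hpos h0 hE).ne'
      · have hb := realize_erase_mem_bdry hc he hn hE
        have hb' := realize_erase_mem_bdry hc' he' hn' hE'
        rw [norm_charInv_eq_one hb, norm_charInv_eq_one hb', mul_one, mul_one] at hN
        rw [hN] at hV
        have hu := smul_right_injective _ (hpos h0' hE').ne' hV
        have hx : C.realize (c.erase e') t = C.realize (c'.erase e') t' := by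
          rw [← C.charExt_charInv hb.1, ← C.charExt_charInv hb'.1]
          exact congrArg _ hu
        obtain ⟨i1, i2⟩ := ih _ (Finset.erase_ssubset he.1) (isChain_erase hc e')
          (isChain_erase hc' e') hE hE' hp hp' hx
        have hcc : c = c' := by rw [← Finset.insert_erase he.1, i1, Finset.insert_erase he'.1]
        have hS := Finset.sum_pos hp hE
        have hS' := Finset.sum_pos hp' hE'
        rw [ratio, ratio, div_eq_div_iff (by linarith) (by linarith)] at hN
        refine ⟨hcc, fun p hpc => ?_⟩
        by_cases hpe : p = e'
        · subst hpe
          rw [← hadd, ← hadd'] at hN ⊢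
          linarith
        · have h3 := i2 p (Finset.mem_erase.2 ⟨hpe, hpc⟩)
          refine mul_right_cancel₀ hS.ne' ?_
          calc t p * (∑ q ∈ c', t' q) * ∑ q ∈ c.erase e', t q
              = t p * ((∑ q ∈ c.erase e', t q) * ∑ q ∈ c', t' q) := by ring
            _ = (t p * ∑ q ∈ c'.erase e', t' q) * ∑ q ∈ c, t q := by rw [hN]; ring
            _ = t' p * (∑ q ∈ c, t q) * ∑ q ∈ c.erase e', t q := by rw [h3]; ring

end

end CellularStratification

/-! ### The embedding of the barycentric subdivision and its image. -/

namespace CellularStratification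

variable {X : Type u} [TopologicalSpace X] {C : CellularStratification.{u, v} X}

theorem nonempty_of_sd (s : C.Sd) : Nonempty X :=
  let ⟨p, _⟩ := s.support_nonempty
  (C.carrier_nonempty p.2).to_type

variable (C) in
/-- The embedding of the barycentric subdivision. -/
noncomputable def sdIncl (s : C.Sd) : X :=
  have := nonempty_of_sd s
  C.realize s.coord.support s.coord

theorem coord_pos (s : C.Sd) {p : C.FacePoset} (hp : p ∈ s.coord.support) : 0 < s.coord p :=
  lt_of_le_of_ne (s.coord_nonneg p) (Finsupp.mem_support_iff.1 hp).symm

theorem sum_coord_pos (s : C.Sd) {c : Finset C.FacePoset} (h : s.coord.support ⊆ c) :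
    0 < ∑ p ∈ c, s.coord p := by
  rw [s.sum_coord_of_subset h]
  exact one_pos

theorem sdIncl_eq_realize [Nonempty X] (s : C.Sd) {c : Finset C.FacePoset}
    (hc : IsChain (· ≤ ·) (c : Set C.FacePoset)) (h : s.coord.support ⊆ c) :
    C.sdIncl s = C.realize c s.coord :=
  (realize_of_subset c hc (fun p _ => s.coord_nonneg p) (sum_coord_pos s h) h
    fun _ _ hp => Finsupp.notMem_support_iff.1 hp).symm

theorem sdIncl_mem_carrier (s : C.Sd) {e : C.FacePoset}
    (he : IsGreatest (s.coord.support : Set C.FacePoset) e) : C.sdIncl s ∈ C.carrier e.2 :=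
  have := nonempty_of_sd s
  realize_mem_carrier he (fun p _ => s.coord_nonneg p) (coord_pos s he.1)

theorem exists_isGreatest_support (s : C.Sd) :
    ∃ e, IsGreatest (s.coord.support : Set C.FacePoset) e :=
  exists_isGreatest_of_isChain s.isChain_support s.support_nonempty

/-- A point lies in the cell that is the greatest vertex of its support. So the preimage of the
closure of `q` is the order complex of the finite poset `Iic q`, which is compact. -/
theorem sdIncl_mem_closure_iff (hN : C.IsNormal) (s : C.Sd) (q : C.FacePoset) :
    C.sdIncl s ∈ closure (C.carrier q.2) ↔ ∀ p ∈ s.coord.support, p ≤ q := by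
  obtain ⟨e, he⟩ := exists_isGreatest_support s
  constructor
  · intro h p hp
    exact (he.2 hp).trans (face_le_of_mem hN (sdIncl_mem_carrier s he) h)
  · intro h
    exact closure_mono_of_le (h e he.1) (subset_closure (sdIncl_mem_carrier s he))

theorem continuous_sdIncl (hr : C.IsRegular) : Continuous C.sdIncl := by
  refine OrderComplex.continuous_iff.2 fun c hc => ?_
  rcases isEmpty_or_nonempty X with hX | hX
  · exact @continuous_of_const _ _ (OrderComplex.simplexTopology c) _ _
      fun s => (nonempty_of_sd s.1).elim fun x => hX.elim x
  let _ := OrderComplex.simplexTopology c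
  have h1 : Continuous fun (s : OrderComplex.simplex c) (p : C.FacePoset) => s.1.coord p :=
    continuous_pi fun p => OrderComplex.continuous_simplex_coord c p
  exact ((continuousOn_realize hr c hc).comp_continuous h1
    fun s => ⟨fun p _ => s.1.coord_nonneg p, sum_coord_pos s.1 s.2⟩).congr
    fun s => (sdIncl_eq_realize s.1 hc s.2).symm

theorem sdIncl_injective (hr : C.IsRegular) : Function.Injective C.sdIncl := by
  intro s s' h
  have := nonempty_of_sd s
  obtain ⟨h1, h2⟩ := realize_injective hr _ s.isChain_support s'.isChain_support
    s.support_nonempty s'.support_nonempty (fun p hp => coord_pos s hp)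
    (fun p hp => coord_pos s' hp) h
  ext p
  by_cases hp : p ∈ s.coord.support
  · have h3 := h2 p hp
    rwa [s.sum_coord_of_subset subset_rfl, s'.sum_coord_of_subset subset_rfl, mul_one,
      mul_one] at h3
  · have hp' := hp
    rw [h1] at hp'
    rw [Finsupp.notMem_support_iff.1 hp, Finsupp.notMem_support_iff.1 hp']

/-- In the weak topology closedness is tested on closures of cells. Over each of these, the part of
`F` is compact, and so is its image, which is then closed by `isClosed_of_isCompact`. -/
theorem isClosedMap_sdIncl (hr : C.IsRegular) (hN : C.IsNormal) : IsClosedMap C.sdIncl := by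
  intro F hF
  rw [C.isStratification.weak_topology.isClosed_iff]
  rintro _ ⟨n, e, rfl⟩
  let q : C.FacePoset := ⟨n, e⟩
  let K : Set C.Sd := {s | s.coord.support ⊆ (finite_Iic hN q).toFinset}
  have hK : ∀ s, s ∈ K ↔ C.sdIncl s ∈ closure (C.carrier e) := fun s => by
    rw [sdIncl_mem_closure_iff hN s q]
    exact ⟨fun h p hp => (finite_Iic hN q).mem_toFinset.1 (h hp),
      fun h p hp => (finite_Iic hN q).mem_toFinset.2 (h p hp)⟩
  have h1 : IsClosed (C.sdIncl '' (K ∩ F)) := by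
    refine isClosed_of_isCompact (p := q) hr
      (((OrderComplex.isCompact_support_subset _).inter_right hF).image (continuous_sdIncl hr)) ?_
    rintro _ ⟨s, hs, rfl⟩
    exact (hK s).1 hs.1
  convert h1.preimage (continuous_subtype_val (p := (· ∈ closure (C.carrier e)))) using 1
  ext x
  constructor
  · rintro ⟨s, hs, hx⟩
    exact ⟨s, ⟨(hK s).2 (hx ▸ x.2), hs⟩, hx⟩
  · rintro ⟨s, hs, hx⟩
    exact ⟨s, hs.2, hx⟩

theorem isClosedEmbedding_sdIncl (hr : C.IsRegular) (hN : C.IsNormal) :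
    IsClosedEmbedding C.sdIncl :=
  .of_continuous_injective_isClosedMap (continuous_sdIncl hr) (sdIncl_injective hr)
    (isClosedMap_sdIncl hr hN)

theorem realize_mem_range [Nonempty X] {c : Finset C.FacePoset} {t : C.FacePoset → ℝ}
    (hc : IsChain (· ≤ ·) (c : Set C.FacePoset)) (h0 : ∀ p ∈ c, 0 ≤ t p)
    (hpos : 0 < ∑ p ∈ c, t p) : C.realize c t ∈ range C.sdIncl := by
  refine ⟨OrderComplex.ofWeights c (fun p => (∑ q ∈ c, t q)⁻¹ * t p)
    (fun p hp => mul_nonneg (inv_nonneg.2 hpos.le) (h0 p hp))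
    (by rw [← Finset.mul_sum, inv_mul_cancel₀ hpos.ne'])
    (fun p hp q hq _ _ => hc.total hp hq), ?_⟩
  rw [sdIncl_eq_realize _ hc OrderComplex.support_ofWeights_subset]
  exact realize_smul c (inv_ne_zero hpos.ne') fun p hp => OrderComplex.ofWeights_coord_of_mem hp

/-- In coordinates of a cell the image is a cone with vertex 0 over its part in the boundary. This
reduces membership to cells of smaller dimension, for the inductions that follow. -/
theorem charExt_mem_range_iff (hr : C.IsRegular) (hN : C.IsNormal) {n : ℕ} (e : C.cell n)
    {y : EuclideanSpace ℝ (Fin n)} (hy : ‖y‖ < 1) :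
    C.charExt e y ∈ range C.sdIncl ↔
      y = 0 ∨ ‖y‖⁻¹ • y ∈ C.dom e ∧ C.charExt e (‖y‖⁻¹ • y) ∈ range C.sdIncl := by
  classical
  have hX : Nonempty X := ⟨C.charExt e y⟩
  have hyD : y ∈ C.dom e := C.ball_subset_dom e (mem_ball_zero_iff.2 hy)
  let q : C.FacePoset := ⟨n, e⟩
  constructor
  · rintro ⟨s, hs⟩
    obtain ⟨e', he⟩ := exists_isGreatest_support s
    obtain rfl : e' = q :=
      face_eq_of_mem (sdIncl_mem_carrier s he) (hs ▸ C.charExt_mem_carrier hy)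
    have hn : ∀ p ∈ s.coord.support, 0 ≤ s.coord p := fun p _ => s.coord_nonneg p
    have hV : ratio s.coord.support q s.coord •
        C.charInv e (C.realize (s.coord.support.erase q) s.coord) = y := by
      rw [sdIncl_eq_realize s s.isChain_support subset_rfl, C.realize_eq he] at hs
      have h2 := congrArg (C.charInv e) hs
      rwa [charInv_charExt hr (C.smul_mem_dom _ (C.charInv_mem_dom _ _) (ratio_nonneg hn)
        (ratio_le_one hn)), charInv_charExt hr hyD] at h2
    rcases (s.coord.support.erase q).eq_empty_or_nonempty with hE | hE
    · left
      rw [← hV, ratio, hE, Finset.sum_empty, zero_div, zero_smul]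
    · right
      have hb := realize_erase_mem_bdry s.isChain_support he hn hE
      have hS : 0 < ∑ p ∈ s.coord.support.erase q, s.coord p :=
        Finset.sum_pos (fun p hp => coord_pos s (Finset.mem_of_mem_erase hp)) hE
      have hrat : 0 < ratio s.coord.support q s.coord :=
        div_pos hS (sum_coord_pos s subset_rfl)
      have hu : ‖y‖⁻¹ • y = C.charInv e (C.realize (s.coord.support.erase q) s.coord) := by
        have hny : ‖y‖ = ratio s.coord.support q s.coord := by
          rw [← hV, norm_smul, norm_charInv_eq_one hb, mul_one, Real.norm_of_nonneg hrat.le]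
        rw [hny, ← hV, smul_smul, inv_mul_cancel₀ hrat.ne', one_smul]
      rw [hu]
      refine ⟨C.charInv_mem_dom _ _, ?_⟩
      rw [C.charExt_charInv hb.1]
      exact realize_mem_range (isChain_erase s.isChain_support _)
        (fun p hp => hn p (Finset.mem_of_mem_erase hp)) hS
  · have hcentre : C.charExt e 0 ∈ range C.sdIncl := by
      have hg : IsGreatest (({q} : Finset C.FacePoset) : Set C.FacePoset) q := by simp
      have h1 : C.realize {q} (fun _ => 1) = C.charExt e 0 := by
        rw [C.realize_eq hg, ratio, Finset.erase_singleton, Finset.sum_empty, zero_div, zero_smul]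
      rw [← h1]
      exact realize_mem_range (by simp) (fun _ _ => zero_le_one) (by simp)
    rintro (rfl | ⟨hD, s, hs⟩)
    · exact hcentre
    rcases eq_or_ne y 0 with rfl | hy0
    · exact hcentre
    have hny : 0 < ‖y‖ := norm_pos_iff.2 hy0
    have hnu : ‖‖y‖⁻¹ • y‖ = 1 := by
      rw [norm_smul, norm_inv, norm_norm, inv_mul_cancel₀ hny.ne']
    have hb : C.sdIncl s ∈ C.bdry e := hs ▸ charExt_mem_bdry hr hD hnu
    have hle := (sdIncl_mem_closure_iff hN s q).1 hb.1
    have hq : q ∉ s.coord.support := fun h => hb.2 (sdIncl_mem_carrier s ⟨h, hle⟩)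
    have hg : IsGreatest (insert q s.coord.support : Set C.FacePoset) q :=
      ⟨mem_insert _ _, by rintro p (rfl | hp); exacts [le_rfl, hle p hp]⟩
    rw [← Finset.coe_insert] at hg
    -- The weights are chosen so that the ratio at `q` is `‖y‖`, while the boundary point is still
    -- `C.sdIncl s`.
    let w : C.FacePoset → ℝ := fun p => if p = q then 1 - ‖y‖ else ‖y‖ * s.coord p
    have hws : ∀ p ∈ s.coord.support, w p = ‖y‖ * s.coord p := fun p hp =>
      if_neg (by rintro rfl; exact hq hp)
    have hw0 : ∀ p ∈ insert q s.coord.support, 0 ≤ w p := by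
      intro p _
      simp only [w]
      split_ifs
      exacts [sub_nonneg.2 hy.le, mul_nonneg hny.le (s.coord_nonneg p)]
    have hsum : ∑ p ∈ s.coord.support, w p = ‖y‖ := by
      rw [Finset.sum_congr rfl hws, ← Finset.mul_sum, s.sum_coord_of_subset subset_rfl, mul_one]
    have hsum' : ∑ p ∈ insert q s.coord.support, w p = 1 := by
      rw [Finset.sum_insert hq, hsum]
      simp [w]
    have hch : IsChain (· ≤ ·) ((insert q s.coord.support : Finset C.FacePoset) :
        Set C.FacePoset) := by
      rw [Finset.coe_insert]
      exact s.isChain_support.insert fun p hp _ => Or.inr (hle p hp)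
    have h1 : C.realize (insert q s.coord.support) w = C.charExt e y := by
      rw [C.realize_eq hg, ratio, Finset.erase_insert hq, hsum, hsum', div_one,
        realize_smul _ hny.ne' hws, ← sdIncl_eq_realize s s.isChain_support subset_rfl, hs,
        charInv_charExt hr hD, smul_smul, mul_inv_cancel₀ hny.ne', one_smul]
    rw [← h1]
    exact realize_mem_range hch hw0 (by rw [hsum']; exact one_pos)

/-- When `D` is the closed ball, every nonzero point of it has its radial projection in `D`, and the
cone description allows induction on dimension. -/
theorem sdIncl_surjective (hr : C.IsRegular) (hN : C.IsNormal) (hC : C.IsCW) :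
    Function.Surjective C.sdIncl := by
  have key : ∀ (N : ℕ) (p : C.FacePoset) (x : X), p.1 < N → x ∈ C.carrier p.2 →
      x ∈ range C.sdIncl := by
    intro N
    induction N with
    | zero => exact fun p x h => absurd h (Nat.not_lt_zero _)
    | succ N ih =>
      intro p x hp hx
      have hy := norm_charInv_lt_one hr hx
      rw [← C.charExt_charInv (subset_closure hx), charExt_mem_range_iff hr hN _ hy]
      refine or_iff_not_imp_left.2 fun h0 => ?_
      have hnu : ‖‖C.charInv p.2 x‖⁻¹ • C.charInv p.2 x‖ = 1 := by
        rw [norm_smul, norm_inv, norm_norm, inv_mul_cancel₀ (norm_ne_zero_iff.2 h0)]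
      have hD : ‖C.charInv p.2 x‖⁻¹ • C.charInv p.2 x ∈ C.dom p.2 := by
        rw [hC]
        exact mem_closedBall_zero_iff.2 hnu.le
      have hlt := dim_lt_of_lt (cellOf_lt hN (charExt_mem_bdry hr hD hnu))
      exact ⟨hD, ih _ _ (by omega) (C.mem_cellOf _)⟩
  exact fun x => key _ _ x (Nat.lt_succ_self _) (C.mem_cellOf x)

end CellularStratification

/-! ### The deformation onto the subdivision. -/

namespace CellularStratification

variable {X : Type u} [TopologicalSpace X] (C : CellularStratification.{u, v} X)

/-- The part of the domain of a cell that is mapped into the barycentric subdivision. -/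
def core {n : ℕ} (e : C.cell n) : Set (EuclideanSpace ℝ (Fin n)) :=
  {y | y ∈ C.dom e ∧ C.charExt e y ∈ range C.sdIncl}

open Classical in
/-- The deformation of the space to the barycentric subdivision: in coordinates of each cell, it is
the chosen extension of what is given on the boundary. -/
noncomputable def retract (x : X) (t : unitInterval) : X :=
  C.charExt (C.cellOf x).2 (cellHomotopy (C.dom (C.cellOf x).2) (C.core (C.cellOf x).2)
    -- The inequality of dimensions serves termination; for regular normal stratifications it
    -- follows from the other two conditions, see `retract_eq`.
    (fun y t => if _h : (C.cellOf (C.charExt (C.cellOf x).2 y)).1 < (C.cellOf x).1 ∧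
        y ∈ C.dom (C.cellOf x).2 ∧ ‖y‖ = 1 then
      C.charInv (C.cellOf x).2 (retract (C.charExt (C.cellOf x).2 y) t) else 0)
    (C.charInv (C.cellOf x).2 x) t)
termination_by (C.cellOf x).1
decreasing_by exact _h.1

open Classical in
/-- The deformation on the boundary of a cell, in coordinates of the cell. -/
noncomputable def bdryHomotopy {n : ℕ} (e : C.cell n) (y : EuclideanSpace ℝ (Fin n))
    (t : unitInterval) : EuclideanSpace ℝ (Fin n) :=
  -- The fixed value 0 elsewhere matters: `cellHomotopy` makes equal choices only for boundary
  -- homotopies that are equal as functions on the whole space.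
  if y ∈ C.dom e ∧ ‖y‖ = 1 then C.charInv e (C.retract (C.charExt e y) t) else 0

variable {C}

theorem bdryHomotopy_of_mem {n : ℕ} {e : C.cell n} {y : EuclideanSpace ℝ (Fin n)}
    (hy : y ∈ C.dom e) (h1 : ‖y‖ = 1) (t : unitInterval) :
    C.bdryHomotopy e y t = C.charInv e (C.retract (C.charExt e y) t) :=
  if_pos ⟨hy, h1⟩

theorem retract_eq (hr : C.IsRegular) (hN : C.IsNormal) {n : ℕ} {e : C.cell n} {x : X}
    (hx : x ∈ C.carrier e) (t : unitInterval) :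
    C.retract x t = C.charExt e
      (cellHomotopy (C.dom e) (C.core e) (C.bdryHomotopy e) (C.charInv e x) t) := by
  have key : ∀ p : C.FacePoset, C.cellOf x = p → C.retract x t = C.charExt p.2
      (cellHomotopy (C.dom p.2) (C.core p.2) (C.bdryHomotopy p.2) (C.charInv p.2 x) t) := by
    rintro p rfl
    rw [retract]
    congr 2
    funext y t
    rw [bdryHomotopy]
    by_cases h : y ∈ C.dom (C.cellOf x).2 ∧ ‖y‖ = 1
    · rw [if_pos h, dif_pos ⟨dim_lt_of_lt (cellOf_lt hN (charExt_mem_bdry hr h.1 h.2)), h⟩]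
    · rw [if_neg h, dif_neg fun h2 => h h2.2]
  exact key ⟨n, e⟩ (cellOf_eq (p := ⟨n, e⟩) hx)

/-- The deformation restricts to a strong deformation retraction of the set `A`. -/
structure RetractsOn (C : CellularStratification.{u, v} X) (A : Set X) : Prop where
  continuousOn : ContinuousOn (Function.uncurry C.retract) (A ×ˢ univ)
  mapsTo : ∀ x ∈ A, ∀ t, C.retract x t ∈ A
  start : ∀ x ∈ A, C.retract x 0 = x
  finish : ∀ x ∈ A, C.retract x 1 ∈ range C.sdIncl
  stationary : ∀ x ∈ A, x ∈ range C.sdIncl → ∀ t, C.retract x t = x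

/-- The boundary is a finite union of closures of smaller cells, so continuity on these closed sets
suffices. -/
theorem RetractsOn.bdry (hN : C.IsNormal) {p : C.FacePoset}
    (h : ∀ q < p, RetractsOn C (closure (C.carrier q.2))) : RetractsOn C (C.bdry p.2) := by
  have hmem : ∀ x ∈ C.bdry p.2, ∃ q < p, x ∈ closure (C.carrier q.2) := fun x hx =>
    ⟨_, cellOf_lt hN hx, subset_closure (C.mem_cellOf x)⟩
  refine ⟨?_, fun x hx t => ?_, fun x hx => ?_, fun x hx => ?_, fun x hx => ?_⟩
  · have hfin : Finite (Iio p) := (finite_Iic hN p).subset Iio_subset_Iic_self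
    have h1 : C.bdry p.2 ×ˢ (univ : Set unitInterval) =
        ⋃ q : Iio p, closure (C.carrier q.1.2) ×ˢ univ := by
      rw [bdry_eq_biUnion hN, biUnion_eq_iUnion, iUnion_prod_const]
    rw [h1]
    exact (locallyFinite_of_finite _).continuousOn_iUnion
      (fun q => isClosed_closure.prod isClosed_univ) fun q => (h q.1 q.2).continuousOn
  · obtain ⟨q, hq, hxq⟩ := hmem x hx
    exact closure_subset_bdry_of_lt hq ((h q hq).mapsTo x hxq t)
  · obtain ⟨q, hq, hxq⟩ := hmem x hx
    exact (h q hq).start x hxq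
  · obtain ⟨q, hq, hxq⟩ := hmem x hx
    exact (h q hq).finish x hxq
  · obtain ⟨q, hq, hxq⟩ := hmem x hx
    exact (h q hq).stationary x hxq

/-- The end map is prescribed on the sphere by the deformation at time 1 and on the core by the
identity. Lifted through the embedding `C.sdIncl`, these values become a map to the order complex of
`Iic p`, which extends over the domain because `p` is greatest. -/
theorem RetractsOn.exists_retraction (hr : C.IsRegular) (hN : C.IsNormal) {p : C.FacePoset}
    (h : RetractsOn C (C.bdry p.2)) :
    ∃ R : C.dom p.2 → C.dom p.2, Continuous R ∧ (∀ y, (R y).1 ∈ C.core p.2) ∧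
      (∀ y : C.dom p.2, ‖y.1‖ = 1 → (R y).1 = C.bdryHomotopy p.2 y 1) ∧
      ∀ y : C.dom p.2, y.1 ∈ C.core p.2 → R y = y := by
  classical
  have hemb := isClosedEmbedding_sdIncl hr hN
  have hφ : Continuous fun y : C.dom p.2 => C.charExt p.2 y :=
    (C.continuousOn_charExt p.2).domRestrict
  let Zs : Set (C.dom p.2) := {y | ‖y.1‖ = 1}
  let ZB : Set (C.dom p.2) := {y | C.charExt p.2 y ∈ range C.sdIncl}
  have cs : IsClosed Zs := isClosed_eq continuous_subtype_val.norm continuous_const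
  have cB : IsClosed ZB := hemb.isClosed_range.preimage hφ
  let g : C.dom p.2 → X := fun y =>
    if ‖y.1‖ = 1 then C.retract (C.charExt p.2 y) 1 else C.charExt p.2 y
  have gs : ∀ y ∈ Zs, g y = C.retract (C.charExt p.2 y) 1 := fun y hy => if_pos hy
  have hb : ∀ y ∈ Zs, C.charExt p.2 y ∈ C.bdry p.2 := fun y hy => charExt_mem_bdry hr y.2 hy
  have gB : ∀ y ∈ ZB, g y = C.charExt p.2 y := by
    intro y hy
    by_cases h1 : ‖y.1‖ = 1
    · exact (gs y h1).trans (h.stationary _ (hb y h1) hy 1)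
    · exact if_neg h1
  have hg : ContinuousOn g (Zs ∪ ZB) := by
    refine ContinuousOn.union_of_isClosed ?_ (hφ.continuousOn.congr gB) cs cB
    refine ContinuousOn.congr ?_ gs
    exact h.continuousOn.comp (hφ.prodMk continuous_const).continuousOn
      fun y hy => ⟨hb y hy, mem_univ _⟩
  have hgr : ∀ y : (Zs ∪ ZB : Set (C.dom p.2)), ∃ s, C.sdIncl s = g y := by
    rintro ⟨y, hy | hy⟩
    · obtain ⟨s, hs⟩ := h.finish _ (hb y hy)
      exact ⟨s, hs.trans (gs y hy).symm⟩
    · obtain ⟨s, hs⟩ := hy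
      exact ⟨s, hs.trans (gB y ⟨s, hs⟩).symm⟩
  choose s hs using hgr
  have hsc : Continuous s := by
    rw [hemb.isInducing.continuous_iff]
    exact hg.domRestrict.congr fun y => (hs y).symm
  have hgcl : ∀ y ∈ Zs ∪ ZB, g y ∈ closure (C.carrier p.2) := by
    rintro y (hy | hy)
    · rw [gs y hy]; exact (h.mapsTo _ (hb y hy) 1).1
    · rw [gB y hy]; exact C.charExt_mem_closure y.2
  have hF : ∀ s : C.Sd, s.coord.support ⊆ (finite_Iic hN p).toFinset ↔
      C.sdIncl s ∈ closure (C.carrier p.2) := fun s => by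
    rw [sdIncl_mem_closure_iff hN s p]
    exact ⟨fun h q hq => (finite_Iic hN p).mem_toFinset.1 (h hq),
      fun h q hq => (finite_Iic hN p).mem_toFinset.2 (h q hq)⟩
  have hgreat : IsGreatest ((finite_Iic hN p).toFinset : Set C.FacePoset) p := by
    rw [Set.Finite.coe_toFinset]
    exact isGreatest_Iic
  obtain ⟨S, hSc, hSF, hS⟩ := OrderComplex.exists_extension_of_isGreatest (cs.union cB) hgreat hsc
    fun y => (hF _).2 (by rw [hs]; exact hgcl y y.2)
  have hScl : ∀ y, C.sdIncl (S y) ∈ closure (C.carrier p.2) := fun y => (hF _).1 (hSF y)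
  have hSg : ∀ y ∈ Zs ∪ ZB, C.sdIncl (S y) = g y := fun y hy => by rw [hS ⟨y, hy⟩, hs]
  refine ⟨fun y => ⟨C.charInv p.2 (C.sdIncl (S y)), C.charInv_mem_dom _ _⟩, ?_, fun y => ?_,
    fun y hy => ?_, fun y hy => ?_⟩
  · exact ((continuousOn_charInv hr p.2).comp_continuous
      ((continuous_sdIncl hr).comp hSc) hScl).subtype_mk _
  · refine ⟨C.charInv_mem_dom _ _, ?_⟩
    rw [C.charExt_charInv (hScl y)]
    exact mem_range_self _
  · simp only
    rw [hSg y (Or.inl hy), gs y hy, bdryHomotopy_of_mem y.2 hy]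
  · refine Subtype.ext ?_
    simp only
    rw [hSg y (Or.inr hy.2), gB y hy.2, charInv_charExt hr y.2]

theorem RetractsOn.isCellHomotopy (hr : C.IsRegular) (hN : C.IsNormal) {p : C.FacePoset}
    (h : RetractsOn C (C.bdry p.2)) :
    IsCellHomotopy (C.dom p.2) (C.core p.2) (C.bdryHomotopy p.2)
      (cellHomotopy (C.dom p.2) (C.core p.2) (C.bdryHomotopy p.2)) := by
  refine cellHomotopy_spec ?_
  obtain ⟨R, hR, hRB, hR1, hRs⟩ := h.exists_retraction hr hN
  have hb : ∀ y ∈ C.dom p.2, ‖y‖ = 1 → C.charExt p.2 y ∈ C.bdry p.2 := fun y hy h1 =>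
    charExt_mem_bdry hr hy h1
  refine exists_isCellHomotopy (C.ball_subset_dom p.2) (C.dom_subset_closedBall p.2)
    (fun y hy => hy.1) ?_ ?_ ?_ ?_ ?_ hR hRB hR1 hRs
  · have h1 : (Subtype.val ⁻¹' C.core p.2 : Set (C.dom p.2)) =
        (fun y : C.dom p.2 => C.charExt p.2 y) ⁻¹' range C.sdIncl := by
      ext y
      exact ⟨fun h => h.2, fun h => ⟨y.2, h⟩⟩
    rw [h1]
    exact (isClosedEmbedding_sdIncl hr hN).isClosed_range.preimage
      (C.continuousOn_charExt p.2).domRestrict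
  · have h1 : ContinuousOn (fun z : EuclideanSpace ℝ (Fin p.1) × unitInterval =>
        (C.charExt p.2 z.1, z.2)) ((C.dom p.2 ∩ {y | ‖y‖ = 1}) ×ˢ univ) :=
      ((C.continuousOn_charExt p.2).comp continuousOn_fst fun z hz => hz.1.1).prodMk
        continuousOn_snd
    have h2 := (continuousOn_charInv hr p.2).comp
      (h.continuousOn.comp h1 fun z hz => ⟨hb z.1 hz.1.1 hz.1.2, mem_univ _⟩)
      fun z hz => (h.mapsTo _ (hb z.1 hz.1.1 hz.1.2) z.2).1
    exact h2.congr fun z hz => bdryHomotopy_of_mem hz.1.1 hz.1.2 z.2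
  · intro y hy h1 t
    rw [bdryHomotopy_of_mem hy h1]
    exact C.charInv_mem_dom _ _
  · intro y hy h1
    rw [bdryHomotopy_of_mem hy h1, h.start _ (hb y hy h1), charInv_charExt hr hy]
  · intro y hy h1 t
    rw [bdryHomotopy_of_mem hy.1 h1, h.stationary _ (hb y hy.1 h1) hy.2,
      charInv_charExt hr hy.1]

theorem RetractsOn.closure (hr : C.IsRegular) (hN : C.IsNormal) {p : C.FacePoset}
    (h : RetractsOn C (C.bdry p.2)) : RetractsOn C (closure (C.carrier p.2)) := by
  have hK := h.isCellHomotopy hr hN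
  set K := cellHomotopy (C.dom p.2) (C.core p.2) (C.bdryHomotopy p.2) with hKdef
  -- The formula for points of the cell persists on its closure, since `K` restricts on the sphere
  -- to the deformation of the boundary.
  have heq : ∀ x ∈ _root_.closure (C.carrier p.2), ∀ t,
      C.retract x t = C.charExt p.2 (K (C.charInv p.2 x) t) := by
    intro x hx t
    by_cases hxp : x ∈ C.carrier p.2
    · exact retract_eq hr hN hxp t
    · have hb : x ∈ C.bdry p.2 := ⟨hx, hxp⟩
      have hn := norm_charInv_eq_one hb
      rw [hK.boundary _ (C.charInv_mem_dom _ _) hn, bdryHomotopy_of_mem (C.charInv_mem_dom _ _) hn,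
        C.charExt_charInv hx, C.charExt_charInv (h.mapsTo x hb t).1]
  have hD := fun x => C.charInv_mem_dom p.2 x
  refine ⟨?_, fun x hx t => ?_, fun x hx => ?_, fun x hx => ?_, fun x hx hxr t => ?_⟩
  · have h1 : ContinuousOn (fun z : X × unitInterval => (C.charInv p.2 z.1, z.2))
        (_root_.closure (C.carrier p.2) ×ˢ univ) :=
      ((continuousOn_charInv hr p.2).comp continuousOn_fst fun z hz => hz.1).prodMk
        continuousOn_snd
    have h2 := (C.continuousOn_charExt p.2).comp
      (hK.continuousOn.comp h1 fun z _ => ⟨hD z.1, mem_univ _⟩) fun z _ => hK.mapsTo _ (hD z.1) z.2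
    exact h2.congr fun z hz => heq z.1 hz.1 z.2
  · rw [heq x hx]
    exact C.charExt_mem_closure (hK.mapsTo _ (hD x) t)
  · rw [heq x hx, hK.start _ (hD x), C.charExt_charInv hx]
  · rw [heq x hx]
    exact (hK.finish _ (hD x)).2
  · rw [heq x hx, hK.stationary _ ⟨hD x, by rwa [C.charExt_charInv hx]⟩, C.charExt_charInv hx]

theorem retractsOn_closure (hr : C.IsRegular) (hN : C.IsNormal) (p : C.FacePoset) :
    RetractsOn C (closure (C.carrier p.2)) := by
  have key : ∀ (N : ℕ) (p : C.FacePoset), p.1 < N → RetractsOn C (closure (C.carrier p.2)) := by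
    intro N
    induction N with
    | zero => exact fun p h => absurd h (Nat.not_lt_zero _)
    | succ N ih =>
      intro p hp
      refine (RetractsOn.bdry hN fun q hq => ih q ?_).closure hr hN
      have := dim_lt_of_lt hq
      omega
  exact key _ p (Nat.lt_succ_self _)

/-- The weak topology describes continuity on `X`, not on `X × [0, 1]`. So the deformation is
curried to a map from `X` to the space of paths, tested on closures of cells, and uncurried again as
the interval is locally compact. -/
theorem continuous_retract (hr : C.IsRegular) (hN : C.IsNormal) :
    Continuous (Function.uncurry C.retract) := by
  have hx : ∀ x, x ∈ closure (C.carrier (C.cellOf x).2) := fun x => subset_closure (C.mem_cellOf x)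
  let F : X → C(unitInterval, X) := fun x => ⟨C.retract x, by
    have h := (retractsOn_closure hr hN (C.cellOf x)).continuousOn
    exact h.comp_continuous (f := fun t => (x, t)) (by fun_prop) fun t => ⟨hx x, mem_univ _⟩⟩
  have hF : Continuous F := by
    refine C.isStratification.weak_topology.continuous_iff.2 ?_
    rintro _ ⟨n, e, rfl⟩
    exact ContinuousMap.continuousOn_of_continuousOn_uncurry F
      (retractsOn_closure hr hN ⟨n, e⟩).continuousOn
  exact ContinuousMap.continuous_uncurry_of_continuous ⟨F, hF⟩

/-- The deformation as a continuous map. -/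
noncomputable def retraction (hr : C.IsRegular) (hN : C.IsNormal) : C(X × unitInterval, X) :=
  ⟨Function.uncurry C.retract, continuous_retract hr hN⟩

theorem isStrongDeformationRetraction_retraction (hr : C.IsRegular) (hN : C.IsNormal) :
    IsStrongDeformationRetraction (range C.sdIncl) (retraction hr hN) where
  start x := (retractsOn_closure hr hN (C.cellOf x)).start x (subset_closure (C.mem_cellOf x))
  finish x := (retractsOn_closure hr hN (C.cellOf x)).finish x (subset_closure (C.mem_cellOf x))
  stationary x := (retractsOn_closure hr hN (C.cellOf x)).stationary x
    (subset_closure (C.mem_cellOf x))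

end CellularStratification

/-! ### Naturality. -/

namespace CellularStratification

variable {X X' : Type*} [TopologicalSpace X] [TopologicalSpace X']
  {C : CellularStratification.{_, v} X} {C' : CellularStratification.{_, v} X'}

theorem cell_eq_of_carrier_eq {n : ℕ} {e e' : C.cell n} (h : C.carrier e = C.carrier e') :
    e = e' := by
  obtain ⟨x, hx⟩ := C.carrier_nonempty e
  have h1 : (⟨n, e⟩ : C.FacePoset) = ⟨n, e'⟩ := face_eq_of_mem hx (h ▸ hx)
  exact eq_of_heq (Sigma.mk.inj h1).2

/-- The map `f` carries the cell `e` to the cell `e'`, compatibly with the characteristic maps. -/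
structure CellMapsTo (C : CellularStratification.{_, v} X) (C' : CellularStratification.{_, v} X')
    (f : X → X') {n : ℕ} (e : C.cell n) (e' : C'.cell n) : Prop where
  dom_subset : C.dom e ⊆ C'.dom e'
  image_carrier : f '' C.carrier e = C'.carrier e'
  charExt_eq : ∀ y ∈ C.dom e, C'.charExt e' y = f (C.charExt e y)

theorem CellMapsTo.charInv_eq (hr' : C'.IsRegular) {f : X → X'} {n : ℕ} {e : C.cell n}
    {e' : C'.cell n} (h : CellMapsTo C C' f e e') {x : X} (hx : x ∈ closure (C.carrier e)) :
    C'.charInv e' (f x) = C.charInv e x := by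
  have hD := C.charInv_mem_dom e x
  conv_lhs => rw [← C.charExt_charInv hx, ← h.charExt_eq _ hD]
  exact charInv_charExt hr' (h.dom_subset hD)

theorem CellMapsTo.charExt_eq_of_dom_eq {f : X → X'} {n : ℕ} {e : C.cell n} {e' : C'.cell n}
    (h : CellMapsTo C C' f e e') (hD : C.dom e = C'.dom e') (y : EuclideanSpace ℝ (Fin n)) :
    C'.charExt e' y = f (C.charExt e y) := by
  by_cases hy : y ∈ C.dom e
  · exact h.charExt_eq y hy
  · have h0 := h.charExt_eq 0 (C.zero_mem_dom e)
    rw [C.charExt_of_mem (C.zero_mem_dom e), C'.charExt_of_mem (C'.zero_mem_dom e')] at h0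
    rw [charExt, charExt, dif_neg hy, dif_neg (hD ▸ hy), h0]

section sdMap

variable {f : X → X'} (hf : C.MapsCells C'.toCellSystem f)

theorem image_carrier_choose {n : ℕ} (e : C.cell n) :
    f '' C.carrier e = C'.carrier (hf.2 e).choose :=
  (hf.2 e).choose_spec

theorem faceMap_injective (hinj : Function.Injective f) : Function.Injective (faceMap hf) := by
  intro p q hpq
  have h1 : ∀ p : C.FacePoset, f '' C.carrier p.2 = C'.carrier (faceMap hf p).2 := fun p =>
    image_carrier_choose hf p.2
  have h2 : C.carrier p.2 = C.carrier q.2 :=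
    hinj.image_injective ((h1 p).trans (hpq ▸ (h1 q).symm))
  obtain ⟨x, hx⟩ := C.carrier_nonempty p.2
  exact face_eq_of_mem hx (h2 ▸ hx)

open Classical in
-- The construction evaluates characteristic maps only at points of the smaller domain, where those
-- of `C` and `C'` correspond; the domains need not be equal.
theorem map_realize [Nonempty X] [Nonempty X'] (hr' : C'.IsRegular) (hinj : Function.Injective f)
    (hcell : ∀ p : C.FacePoset, CellMapsTo C C' f p.2 (hf.2 p.2).choose) (c : Finset C.FacePoset)
    (hc : IsChain (· ≤ ·) (c : Set C.FacePoset)) (hne : c.Nonempty) {t : C.FacePoset → ℝ}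
    {t' : C'.FacePoset → ℝ} (h0 : ∀ p ∈ c, 0 < t p) (ht : ∀ p, t' (faceMap hf p) = t p) :
    C'.realize (c.image (faceMap hf)) t' = f (C.realize c t) := by
  induction c using Finset.strongInduction with
  | H c ih =>
    have hinj' := faceMap_injective hf hinj
    have hn : ∀ p ∈ c, 0 ≤ t p := fun p hp => (h0 p hp).le
    obtain ⟨e, he⟩ := exists_isGreatest_of_isChain hc hne
    have he' : IsGreatest (c.image (faceMap hf) : Set C'.FacePoset) (faceMap hf e) := by
      rw [Finset.coe_image]
      exact (faceMap hf).monotone.map_isGreatest he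
    have hsum : ∀ d : Finset C.FacePoset, ∑ p ∈ d.image (faceMap hf), t' p = ∑ p ∈ d, t p :=
      fun d => by
        rw [Finset.sum_image fun p _ q _ h => hinj' h]
        exact Finset.sum_congr rfl fun p _ => ht p
    have herase : (c.image (faceMap hf)).erase (faceMap hf e) =
        (c.erase e).image (faceMap hf) := (Finset.image_erase hinj' c e).symm
    have hrat : ratio (c.image (faceMap hf)) (faceMap hf e) t' = ratio c e t := by
      rw [ratio, ratio, herase, hsum, hsum]
    rw [C'.realize_eq he', C.realize_eq he, hrat, herase]
    refine Eq.trans ?_ ((hcell e).charExt_eq _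
      (C.smul_mem_dom _ (C.charInv_mem_dom _ _) (ratio_nonneg hn) (ratio_le_one hn)))
    change C'.charExt (hf.2 e.2).choose _ = _
    congr 1
    rcases (c.erase e).eq_empty_or_nonempty with hE | hE
    -- The default points for the empty chain in `X` and `X'` need not correspond under `f`, but
    -- they are multiplied by 0.
    · have h1 : ratio c e t = 0 := by rw [ratio, hE, Finset.sum_empty, zero_div]
      rw [h1, zero_smul, zero_smul]
      rfl
    · have hb := realize_erase_mem_bdry hc he hn hE
      rw [ih _ (Finset.erase_ssubset he.1) (isChain_erase hc e) hE
        fun p hp => h0 p (Finset.mem_of_mem_erase hp)]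
      congr 1
      exact (hcell e).charInv_eq hr' hb.1

theorem sdIncl_sdMap (hr' : C'.IsRegular) (hinj : Function.Injective f)
    (hcell : ∀ p : C.FacePoset, CellMapsTo C C' f p.2 (hf.2 p.2).choose) (s : C.Sd) :
    C'.sdIncl (sdMap hf s) = f (C.sdIncl s) := by
  classical
  have := nonempty_of_sd s
  have : Nonempty X' := this.map f
  have hinj' := faceMap_injective hf hinj
  have h1 : (sdMap hf s).coord.support = s.coord.support.image (faceMap hf) :=
    Finsupp.mapDomain_support_of_injective hinj' s.coord
  rw [sdIncl_eq_realize (sdMap hf s) (sdMap hf s).isChain_support subset_rfl, h1]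
  exact map_realize hf hr' hinj hcell _ s.isChain_support s.support_nonempty
    (fun p hp => coord_pos s hp) fun p => Finsupp.mapDomain_apply hinj' s.coord p

end sdMap

section retract

variable {f : X → X'}

/-- Induction through the cone description. Equality of domains is essential: a larger domain in
`C'` could add rays to the image. -/
theorem map_mem_range_sdIncl_iff (hr : C.IsRegular) (hN : C.IsNormal) (hr' : C'.IsRegular)
    (hN' : C'.IsNormal) (hcell : ∀ p : C.FacePoset, ∃ e' : C'.cell p.1,
      CellMapsTo C C' f p.2 e' ∧ C.dom p.2 = C'.dom e') (x : X) :
    f x ∈ range C'.sdIncl ↔ x ∈ range C.sdIncl := by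
  have key : ∀ (N : ℕ) (p : C.FacePoset) (x : X), p.1 < N → x ∈ C.carrier p.2 →
      (f x ∈ range C'.sdIncl ↔ x ∈ range C.sdIncl) := by
    intro N
    induction N with
    | zero => exact fun p x h => absurd h (Nat.not_lt_zero _)
    | succ N ih =>
      intro p x hp hx
      obtain ⟨e', he', hD⟩ := hcell p
      have hy := norm_charInv_lt_one hr hx
      rw [← C.charExt_charInv (subset_closure hx)]
      set y := C.charInv p.2 x
      rw [← he'.charExt_eq_of_dom_eq hD, charExt_mem_range_iff hr hN _ hy,
        charExt_mem_range_iff hr' hN' _ hy]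
      rcases eq_or_ne y 0 with h0 | h0
      · exact iff_of_true (Or.inl h0) (Or.inl h0)
      · refine or_congr_right (hD ▸ and_congr_right fun hu => ?_)
        have hnu : ‖‖y‖⁻¹ • y‖ = 1 := by
          rw [norm_smul, norm_inv, norm_norm, inv_mul_cancel₀ (norm_ne_zero_iff.2 h0)]
        have hlt := dim_lt_of_lt (cellOf_lt hN (charExt_mem_bdry hr hu hnu))
        rw [he'.charExt_eq_of_dom_eq hD]
        exact ih _ _ (by omega) (C.mem_cellOf _)
  exact key _ _ x (Nat.lt_succ_self _) (C.mem_cellOf x)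

/-- By induction on dimension, corresponding cells have the same domain, the same core and the same
boundary homotopy. Hence `cellHomotopy` returns the same function for both. -/
theorem map_retract (hr : C.IsRegular) (hN : C.IsNormal) (hr' : C'.IsRegular)
    (hN' : C'.IsNormal) (hcell : ∀ p : C.FacePoset, ∃ e' : C'.cell p.1,
      CellMapsTo C C' f p.2 e' ∧ C.dom p.2 = C'.dom e') (x : X) (t : unitInterval) :
    C'.retract (f x) t = f (C.retract x t) := by
  have key : ∀ (N : ℕ) (p : C.FacePoset) (x : X) (t : unitInterval), p.1 < N →
      x ∈ C.carrier p.2 → C'.retract (f x) t = f (C.retract x t) := by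
    intro N
    induction N with
    | zero => exact fun p x t h => absurd h (Nat.not_lt_zero _)
    | succ N ih =>
      intro p x t hp hx
      obtain ⟨e', he', hD⟩ := hcell p
      have hx' : f x ∈ C'.carrier e' := he'.image_carrier ▸ mem_image_of_mem f hx
      have hcore : C'.core e' = C.core p.2 := by
        ext y
        rw [core, core, mem_ofPred_eq, mem_ofPred_eq, ← hD, he'.charExt_eq_of_dom_eq hD,
          map_mem_range_sdIncl_iff hr hN hr' hN' hcell]
      have hbdry : C'.bdryHomotopy e' = C.bdryHomotopy p.2 := by
        funext y s
        by_cases h : y ∈ C.dom p.2 ∧ ‖y‖ = 1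
        · have hb := charExt_mem_bdry hr h.1 h.2
          have hlt := dim_lt_of_lt (cellOf_lt hN hb)
          rw [bdryHomotopy_of_mem h.1 h.2, bdryHomotopy_of_mem (hD ▸ h.1) h.2,
            he'.charExt_eq_of_dom_eq hD, ih _ _ s (by omega) (C.mem_cellOf _)]
          refine he'.charInv_eq hr' ?_
          exact ((RetractsOn.bdry hN fun q _ => retractsOn_closure hr hN q).mapsTo _ hb s).1
        · rw [bdryHomotopy, bdryHomotopy, if_neg h, if_neg (hD ▸ h)]
      rw [retract_eq hr hN hx, retract_eq hr' hN' hx', hcore, hbdry, ← hD,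
        he'.charInv_eq hr' (subset_closure hx), he'.charExt_eq_of_dom_eq hD]
  exact key _ _ x t (Nat.lt_succ_self _) (C.mem_cellOf x)

end retract

theorem cellMapsTo_choose {f : X → X'} (hf : C.MapsCells C'.toCellSystem f)
    (hcell : ∀ p : C.FacePoset, ∃ e' : C'.cell p.1, CellMapsTo C C' f p.2 e')
    (p : C.FacePoset) : CellMapsTo C C' f p.2 (hf.2 p.2).choose := by
  obtain ⟨e', he'⟩ := hcell p
  have h : e' = (hf.2 p.2).choose :=
    cell_eq_of_carrier_eq (he'.image_carrier.symm.trans (image_carrier_choose hf p.2))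
  exact h ▸ he'

theorem exists_cellMapsTo_of_isIso {f : X → X'} (hf : C.IsIso C'.toCellSystem f)
    (p : C.FacePoset) : ∃ e' : C'.cell p.1, CellMapsTo C C' f p.2 e' ∧ C.dom p.2 = C'.dom e' := by
  obtain ⟨e', hD, him, hch⟩ := hf.2 p.2
  refine ⟨e', ⟨hD.subset, him, fun y hy => ?_⟩, hD⟩
  rw [C.charExt_of_mem hy, C'.charExt_of_mem (hD ▸ hy)]
  exact hch y hy (hD ▸ hy)

/-- The domain of `e` is the part of that of `e'` lying over the range of `f`. A closed range
contains the closure of `e'`, so this part is everything. -/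
theorem exists_cellMapsTo_of_isEmb {f : X → X'} (hf : C.IsEmb C'.toCellSystem f)
    (p : C.FacePoset) : ∃ e' : C'.cell p.1, CellMapsTo C C' f p.2 e' ∧
      (IsClosed (range f) → C.dom p.2 = C'.dom e') := by
  obtain ⟨e', hD, him, hch⟩ := hf.2.2.2 p.2
  have hsub : C.dom p.2 ⊆ C'.dom e'.1 := fun y hy => by
    rw [hD] at hy
    exact hy.1
  refine ⟨e'.1, ⟨hsub, ?_, fun y hy => ?_⟩, fun hcl => hsub.antisymm fun y hy => ?_⟩
  · have h2 : Subtype.val '' (rangeFactorization f '' C.carrier p.2)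
        = Subtype.val '' ((Subtype.val : range f → X') ⁻¹' C'.carrier e'.1) :=
      congrArg (fun s => Subtype.val '' s) him
    rwa [Subtype.image_preimage_coe, inter_eq_right.2 e'.2, image_image] at h2
  · rw [C.charExt_of_mem hy, C'.charExt_of_mem (hsub hy)]
    exact congrArg Subtype.val (hch y hy (hD ▸ hy))
  · rw [hD]
    refine ⟨hy, ?_⟩
    rw [← C'.charExt_of_mem hy]
    exact closure_minimal e'.2 hcl (C'.charExt_mem_closure hy)

end CellularStratification

theorem theoremt :
    ∃ (i : ∀ {X : Type u} [TopologicalSpace X] (C : CellularStratification.{u, v} X),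
          C.IsRegular → C.IsTotallyNormal → C.Sd → X)
      (H : ∀ {X : Type u} [TopologicalSpace X] (C : CellularStratification.{u, v} X),
          C.IsRegular → C.IsTotallyNormal → C(X × unitInterval, X)),
      -- embedding as a strong deformation retract; homeomorphism in the CW case
      (∀ (X : Type u) [TopologicalSpace X] (C : CellularStratification.{u, v} X)
          (hr : C.IsRegular) (ht : C.IsTotallyNormal),
          IsEmbedding (i C hr ht) ∧
          IsStrongDeformationRetraction (range (i C hr ht)) (H C hr ht) ∧
          (C.IsCW → IsHomeomorph (i C hr ht))) ∧
      -- naturality for embeddings of cellular stratified spaces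
      (∀ (X X' : Type u) [TopologicalSpace X] [TopologicalSpace X']
          (C : CellularStratification.{u, v} X) (C' : CellularStratification.{u, v} X')
          (hr : C.IsRegular) (ht : C.IsTotallyNormal)
          (hr' : C'.IsRegular) (ht' : C'.IsTotallyNormal)
          (f : X → X') (hf : C.IsEmb C'.toCellSystem f),
          (∀ s : C.Sd, i C' hr' ht' (CellularStratification.sdMap hf.mapsCells s) =
            f (i C hr ht s)) ∧
          (IsClosed (range f) → ∀ (x : X) (t : unitInterval),
            H C' hr' ht' (f x, t) = f (H C hr ht (x, t)))) ∧
      -- equivariance for cellular actions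
      (∀ (G : Type w) [Group G] (X : Type u) [TopologicalSpace X] [MulAction G X]
          (C : CellularStratification.{u, v} X)
          (hr : C.IsRegular) (ht : C.IsTotallyNormal)
          (hG : ∀ g : G, C.IsIso C.toCellSystem (fun x : X => g • x)) (g : G),
          (∀ s : C.Sd, i C hr ht (CellularStratification.sdMap (hG g).mapsCells s) =
            g • i C hr ht s) ∧
          ∀ (x : X) (t : unitInterval), H C hr ht (g • x, t) = g • H C hr ht (x, t)) := by
  refine ⟨fun C _ _ => C.sdIncl,
    fun C hr ht => CellularStratification.retraction hr ht.1, ?_, ?_, ?_⟩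
  · intro X _ C hr ht
    have hemb := CellularStratification.isClosedEmbedding_sdIncl hr ht.1
    refine ⟨hemb.isEmbedding,
      CellularStratification.isStrongDeformationRetraction_retraction hr ht.1, fun hC => ?_⟩
    exact isHomeomorph_iff_isEmbedding_surjective.2
      ⟨hemb.isEmbedding, CellularStratification.sdIncl_surjective hr ht.1 hC⟩
  · intro X X1 _ _ C C1 hr ht hr1 ht1 f hf
    have hcell := CellularStratification.exists_cellMapsTo_of_isEmb hf
    refine ⟨CellularStratification.sdIncl_sdMap hf.mapsCells hr1 hf.1.injective
      (CellularStratification.cellMapsTo_choose hf.mapsCells fun p =>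
        let ⟨e, he, _⟩ := hcell p
        ⟨e, he⟩), fun hcl => ?_⟩
    exact CellularStratification.map_retract hr ht.1 hr1 ht1.1 fun p =>
      let ⟨e, he, hD⟩ := hcell p
      ⟨e, he, hD hcl⟩
  · intro G _ X _ _ C hr ht hG g
    have hcell := CellularStratification.exists_cellMapsTo_of_isIso (hG g)
    refine ⟨CellularStratification.sdIncl_sdMap (hG g).mapsCells hr (hG g).1.injective
      (CellularStratification.cellMapsTo_choose (hG g).mapsCells fun p =>
        let ⟨e, he, _⟩ := hcell p
        ⟨e, he⟩), ?_⟩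
    exact CellularStratification.map_retract hr ht.1 hr ht.1 hcell
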